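/- Let $\mathbb{K}$ be a number field of degree $n\ge 2$ with $r_1$ real places, $r_2$ complex places and discriminant $\Delta_{\mathbb{K}}$. Put $$f(s)=\Big(\frac{2^{1-s}}{\pi^{s}}\Big)^{n}|\Delta_{\mathbb{K}}|^{s-\frac12}\Big(\cos\frac{\pi s}{2}\Big)^{r_1+r_2}\Big(\sin\frac{\pi s}{2}\Big)^{r_2}\Gamma(s)^{n},$$ so that the Dedekind zeta-function of $\mathbb{K}$ satisfies $\zeta_{\mathbb{K}}(1-s)=f(s)\zeta_{\mathbb{K}}(s)$. Let $0<\eta<\tfrac12$ or $\eta=\tfrac12+\tfrac1{2n}$, and for $x>0$ let $$K(x)=K_\eta(x)=\frac1{2\pi i}\int_{-\eta-i\infty}^{-\eta+i\infty}\frac{x^{s+n}}{s(s+1)\cdots(s+n)}\,f(s)^{-1}\,ds ,$$ where the integral is the limit as $T\to\infty$ of the integral from $-\eta-iT$ to $-\eta+iT$. This limit exists for every $x>0$. For $v>0$ and $w>0$ let $$\Delta_vK(w)=\sum_{\ell=0}^{n}(-1)^{n-\ell}\binom{n}{\ell}K(w+\ell v).$$ Then, for all $w>1$ and $0<v<w$,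 $$|\Delta_vK(w)|\le Q_2(n)\,(4n)^n\,|\Delta_{\mathbb{K}}|^{1+\frac1{2n}}\,w^{\,n-\frac12-\frac1{2n}}$$ and $$|\Delta_vK(w)|\le Q_3(n)\,(n+1)^{\frac12-\frac1{2n}}\,v^{n}\,|\Delta_{\mathbb{K}}|^{\frac1{2n}}\,w^{\frac12-\frac1{2n}},$$ where $$Q_2(n)=2^{\frac32}\pi^{-\frac n2-\frac32}e^{4n-\frac12}\sqrt{3n},\qquad Q_3(n)=2^{n+\frac32}\pi^{\frac n2-\frac32}e^{\,n\left(1+\frac{4n}{n-1}\right)-\frac12}\sqrt{3n}.$$ -/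

import Mathlib

open Filter Topology

noncomputable section

/-- The factor `f(s)` of the functional equation `ζ_K(1 - s) = f(s) ζ_K(s)`:
`(2^(1-s) / π^s)^n |Δ|^(s-1/2) cos(πs/2)^(r₁+r₂) sin(πs/2)^r₂ Γ(s)^n`. -/
def functionalFactor (K : Type*) [Field K] [NumberField K] (s : ℂ) : ℂ :=
  ((2 : ℂ) ^ (1 - s) / (Real.pi : ℂ) ^ s) ^ Module.finrank ℚ K
    * (((|NumberField.discr K| : ℤ) : ℂ) ^ (s - 1 / 2))
    * Complex.cos (Real.pi * s / 2) ^
        (NumberField.InfinitePlace.nrRealPlaces K + NumberField.InfinitePlace.nrComplexPlaces K)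
    * Complex.sin (Real.pi * s / 2) ^ NumberField.InfinitePlace.nrComplexPlaces K
    * Complex.Gamma s ^ Module.finrank ℚ K

/-- The integrand `x^(s+n) / (s (s+1) ⋯ (s+n)) · f(s)⁻¹`. -/
def landauIntegrand (K : Type*) [Field K] [NumberField K] (x : ℝ) (s : ℂ) : ℂ :=
  (x : ℂ) ^ (s + (Module.finrank ℚ K : ℂ))
    / (∏ j ∈ Finset.range (Module.finrank ℚ K + 1), (s + (j : ℂ)))
    * (functionalFactor K s)⁻¹

/-- The truncated integral `1/(2πi) ∫_{-η-iT}^{-η+iT} x^(s+n) / (s ⋯ (s+n)) f(s)⁻¹ ds`,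
parametrized by `s = -η + it`, `ds = i dt`. -/
def landauTruncated (K : Type*) [Field K] [NumberField K] (η x T : ℝ) : ℂ :=
  1 / (2 * Real.pi * Complex.I) *
    ∫ t in (-T)..T, landauIntegrand K x (-(η : ℂ) + (t : ℂ) * Complex.I) * Complex.I

/-- `K_η(x) = 1/(2πi) ∫_{-η-i∞}^{-η+i∞} x^(s+n) / (s ⋯ (s+n)) f(s)⁻¹ ds`, the integral over the
vertical line being the limit of the integrals over the segments from `-η-iT` to `-η+iT`. -/
def landauK (K : Type*) [Field K] [NumberField K] (η x : ℝ) : ℂ :=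
  limUnder atTop (fun T : ℝ => landauTruncated K η x T)

/-- The `n`-th difference `Δ_v g(w) = ∑_{ℓ=0}^n (-1)^(n-ℓ) C(n,ℓ) g(w + ℓ v)`. -/
def nthDifference (n : ℕ) (v : ℝ) (g : ℝ → ℂ) (w : ℝ) : ℂ :=
  ∑ l ∈ Finset.range (n + 1), (-1 : ℂ) ^ (n - l) * (n.choose l : ℂ) * g (w + (l : ℝ) * v)

/-- `Q₂(n) = 2^(3/2) π^(-n/2-3/2) e^(4n-1/2) √(3n)`. -/
def constQ2 (n : ℕ) : ℝ :=
  (2 : ℝ) ^ (3 / 2 : ℝ) * Real.pi ^ (-(n : ℝ) / 2 - 3 / 2) * Real.exp (4 * (n : ℝ) - 1 / 2)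
    * Real.sqrt (3 * (n : ℝ))

/-- `Q₃(n) = 2^(n+3/2) π^(n/2-3/2) e^(n(1+4n/(n-1))-1/2) √(3n)`. -/
def constQ3 (n : ℕ) : ℝ :=
  (2 : ℝ) ^ ((n : ℝ) + 3 / 2) * Real.pi ^ ((n : ℝ) / 2 - 3 / 2)
    * Real.exp ((n : ℝ) * (1 + 4 * (n : ℝ) / ((n : ℝ) - 1)) - 1 / 2)
    * Real.sqrt (3 * (n : ℝ))

/-- `Q₄(n) = Q₂(n) (4n)^n`. -/
def constQ4 (n : ℕ) : ℝ := constQ2 n * (4 * (n : ℝ)) ^ n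

/-- `Q₅(n) = Q₃(n) (n+1)^(1/2-1/(2n))`. -/
def constQ5 (n : ℕ) : ℝ := constQ3 n * ((n : ℝ) + 1) ^ (1 / 2 - 1 / (2 * (n : ℝ)))

end

/-! Put c = 1/2 + 1/(2n), z = 1 - s and X = x(2π)^n/|Δ|. In the strip |Re s| < 1 one has 1/f(s) =
f(1 - s), so the integrand is a constant times X^(-z) P(z) divided by linear factors, where P is the
product of cosines, sines and Gamma factors (`trigGammaProduct`). In P the exponential growth of the
trigonometric factors cancels the decay of Γ: high in the upper half plane |P(z)| is of order
|z|^(n(Re z - 1/2)) up to a factor C^n, and P'/P = n log(Im z) + O(n/Im z). Along a vertical line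
X^(-z) P(z) thus oscillates with phase derivative n log(t/t₀), which vanishes only at t₀ = X^(1/n).

On Re z = c the product has size |z|^(1/2). Divided by one linear factor it decays only like
t^(-1/2), so it is not absolutely integrable, but a stationary phase argument bounds its truncated
integrals by 5·240^n X^(-c), uniformly in the height (`norm_integral_trigGammaProduct_le`). Two
lines in the s-plane reduce to this estimate: - Re s = -c. The recurrence of Γ passes from z + 1 to
z at the cost of z^n, which n of the n + 1 denominators absorb. This bounds K(x) by x^(n-c), and the
triangle inequality gives the first estimate of the difference. - Re s = 1 - c. Differentiating n
times in x leaves only the denominator s. An n-th difference is at most v^n times the supremum of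
the n-th derivative, which gives the second estimate.

The lines may be exchanged (`exists_tendsto_integral_verticalKernel`): the pole at s = 0 is
removable because P(1) = 0, and the horizontal edges at height T contribute O(T^(-1/2)). The
numerical constants fit because 240 < √2·π·e^4 (`ten_mul_pow_le`). -/

/-! ### Binet's series and Stirling's formula for Γ in the upper right quadrant -/

/-- The summand `(z + 1/2) log (1 + 1/z) - 1` of Binet's series for `log Γ`. -/
noncomputable def binetTerm (z : ℂ) : ℂ := (z + 1 / 2) * Complex.log (1 + z⁻¹) - 1

/-- Binet's series `∑ₖ binetTerm (z + k)`, the remainder in Stirling's formula. -/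
noncomputable def binetSum (z : ℂ) : ℂ := ∑' k : ℕ, binetTerm (z + k)

/-- The main term `(z - 1/2) log z - z` of Stirling's formula. -/
noncomputable def stirlingMain (z : ℂ) : ℂ := (z - 1 / 2) * Complex.log z - z

/-- With w = 1/z and log(1 + w) = w - w²/2 + r, the terms of order 0 and 1 in w cancel and -w²/4 +
rz + r/2 remains. Since |r| ≤ |w|³, the constant is 1/4 + 1 + 1/3 < 8/5. -/
lemma norm_binetTerm_le {z : ℂ} (hz : 3 / 2 ≤ ‖z‖) : ‖binetTerm z‖ ≤ 8 / 5 / ‖z‖ ^ 2 := by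
  have hz0 : z ≠ 0 := by
    intro h; rw [h, norm_zero] at hz; norm_num at hz
  set w := z⁻¹ with hw
  have hwn : ‖w‖ ≤ 2 / 3 := by
    rw [hw, norm_inv]
    calc ‖z‖⁻¹ ≤ (3 / 2 : ℝ)⁻¹ := inv_anti₀ (by norm_num) hz
      _ = 2 / 3 := by norm_num
  have hzw : z * w = 1 := mul_inv_cancel₀ hz0
  have hnzw : ‖z‖ * ‖w‖ = 1 := by rw [← norm_mul, hzw, norm_one]
  have h := Complex.norm_log_sub_logTaylor_le 2 (z := w) (by linarith)
  set r := Complex.log (1 + w) - Complex.logTaylor 3 w with hr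
  have hT : Complex.logTaylor 3 w = w - w ^ 2 / 2 := by
    simp [Complex.logTaylor, Finset.sum_range_succ]; ring
  have hrn : ‖r‖ ≤ ‖w‖ ^ 3 := by
    have h1 : (1 - ‖w‖)⁻¹ ≤ 3 := by
      calc (1 - ‖w‖)⁻¹ ≤ (1 / 3 : ℝ)⁻¹ := inv_anti₀ (by norm_num) (by linarith)
        _ = 3 := by norm_num
    calc ‖r‖ ≤ ‖w‖ ^ 3 * (1 - ‖w‖)⁻¹ / 3 := by
          refine h.trans (le_of_eq ?_); norm_num
      _ ≤ ‖w‖ ^ 3 * 3 / 3 := by gcongr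
      _ = _ := by ring
  have hb : binetTerm z = -(w ^ 2 / 4) + r * z + r / 2 := by
    have hl : Complex.log (1 + w) = r + (w - w ^ 2 / 2) := by rw [hr, hT]; ring
    rw [binetTerm, ← hw, hl]
    linear_combination (1 - w / 2) * hzw
  have h8 : 8 / 5 / ‖z‖ ^ 2 = 8 / 5 * ‖w‖ ^ 2 := by
    rw [hw, norm_inv]; field_simp
  rw [hb, h8]
  have e1 : ‖-(w ^ 2 / 4)‖ = ‖w‖ ^ 2 / 4 := by simp
  have e2 : ‖r * z‖ ≤ ‖w‖ ^ 2 := by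
    rw [norm_mul]
    calc ‖r‖ * ‖z‖ ≤ ‖w‖ ^ 3 * ‖z‖ := by gcongr
      _ = ‖w‖ ^ 2 * (‖z‖ * ‖w‖) := by ring
      _ = _ := by rw [hnzw, mul_one]
  have e3 : ‖r / 2‖ ≤ ‖w‖ ^ 2 / 3 := by
    rw [norm_div]; simp only [Complex.norm_ofNat]
    have : ‖w‖ ^ 3 ≤ ‖w‖ ^ 2 * (2 / 3) := by
      rw [pow_succ]; gcongr
    linarith
  have := norm_add₃_le (a := -(w ^ 2 / 4)) (b := r * z) (c := r / 2)
  nlinarith [sq_nonneg ‖w‖]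

/-- The majorant is chosen to telescope: for A = Re z + Im z - 1/2 + k one has A(A + 1) ≤ (Re z + k
+ Im z)² ≤ 2|z + k|². -/
lemma norm_binetTerm_add_le {z : ℂ} (hre : 0 < z.re) (him : 3 / 2 ≤ z.im) (k : ℕ) :
    ‖binetTerm (z + k)‖ ≤
      16 / 5 * (1 / (z.re + z.im - 1 / 2 + k) - 1 / (z.re + z.im - 1 / 2 + (k + 1 : ℕ))) := by
  have hk : (0 : ℝ) ≤ k := Nat.cast_nonneg k
  have hn2 : ‖z + k‖ ^ 2 = (z.re + k) ^ 2 + z.im ^ 2 := by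
    rw [Complex.sq_norm, Complex.normSq_apply]; simp; ring
  have hn : 3 / 2 ≤ ‖z + k‖ := by
    refine le_trans him (le_trans (le_abs_self _) ?_)
    simpa using Complex.abs_im_le_norm (z + k)
  refine (norm_binetTerm_le hn).trans ?_
  have hA : 0 < z.re + z.im - 1 / 2 + k := by linarith
  have hpos : 0 < (z.re + k) ^ 2 + z.im ^ 2 := by positivity
  rw [hn2]
  push_cast
  rw [div_sub_div _ _ hA.ne' (by linarith), mul_div_assoc', div_le_div_iff₀ hpos
    (mul_pos hA (by linarith))]
  nlinarith [sq_nonneg (z.re + k - z.im)]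

lemma hasSum_telescoping_inv {a : ℝ} (ha : 0 < a) :
    HasSum (fun k : ℕ => 16 / 5 * (1 / (a + k) - 1 / (a + (k + 1 : ℕ)))) (16 / 5 / a) := by
  have h1 : HasSum (fun k : ℕ => 1 / (a + k) - 1 / (a + (k + 1 : ℕ))) (1 / a) := by
    rw [hasSum_iff_tendsto_nat_of_nonneg]
    · have : ∀ N : ℕ, ∑ k ∈ Finset.range N, (1 / (a + k) - 1 / (a + (k + 1 : ℕ)))
          = 1 / a - 1 / (a + N) := by
        intro N
        rw [Finset.sum_range_sub' (fun k : ℕ => 1 / (a + k))]; simp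
      simp_rw [this]
      have h0 : Tendsto (fun N : ℕ => 1 / (a + (N : ℝ))) atTop (𝓝 0) := by
        simp_rw [one_div]
        exact tendsto_inv_atTop_zero.comp
          (tendsto_atTop_add_const_left _ _ tendsto_natCast_atTop_atTop)
      simpa using (tendsto_const_nhds (x := 1 / a)).sub h0
    · intro k
      rw [sub_nonneg]
      apply one_div_le_one_div_of_le (by positivity)
      push_cast; linarith
  have := h1.mul_left (16 / 5)
  rwa [mul_one_div] at this

lemma summable_binetTerm {z : ℂ} (hre : 0 < z.re) (him : 3 / 2 ≤ z.im) :
    Summable fun k : ℕ => binetTerm (z + k) :=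
  Summable.of_norm_bounded (hasSum_telescoping_inv (a := z.re + z.im - 1 / 2)
    (by linarith)).summable (norm_binetTerm_add_le hre him)

lemma norm_binetSum_le {z : ℂ} (hre : 0 < z.re) (him : 3 / 2 ≤ z.im) :
    ‖binetSum z‖ ≤ 16 / 5 / (z.re + z.im - 1 / 2) :=
  tsum_of_norm_bounded (hasSum_telescoping_inv (by linarith)) (norm_binetTerm_add_le hre him)

lemma isOpen_re_pos_im_gt : IsOpen {z : ℂ | 0 < z.re ∧ 3 / 2 < z.im} :=
  (isOpen_lt continuous_const Complex.continuous_re).inter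
    (isOpen_lt continuous_const Complex.continuous_im)

lemma differentiableOn_binetSum :
    DifferentiableOn ℂ binetSum {z : ℂ | 0 < z.re ∧ 3 / 2 < z.im} := by
  have hs : Summable fun k : ℕ => (8 / 5 : ℝ) / ((k : ℝ) + 1) ^ 2 * 2 := by
    have := (summable_nat_add_iff 1).2 (Real.summable_one_div_nat_pow.2 (one_lt_two))
    refine ((this.mul_left (8 / 5)).mul_right 2).congr fun k => ?_
    push_cast; ring
  refine Complex.differentiableOn_tsum_of_summable_norm hs ?_ isOpen_re_pos_im_gt ?_
  · rintro k z ⟨h1, h2⟩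
    have hk : (0 : ℝ) ≤ k := Nat.cast_nonneg k
    have hz0 : z + k ≠ 0 := by
      intro h
      have := congrArg Complex.re h
      simp at this; linarith
    have hsl : 1 + (z + k)⁻¹ ∈ Complex.slitPlane := by
      left
      have : 0 < ((z + k)⁻¹).re := by
        rw [Complex.inv_re]
        exact div_pos (by simp; linarith) (Complex.normSq_pos.2 hz0)
      simp only [Complex.add_re, Complex.one_re] at this ⊢; linarith
    unfold binetTerm
    refine DifferentiableAt.differentiableWithinAt ?_
    refine DifferentiableAt.sub (DifferentiableAt.mul (by fun_prop) ?_) (by fun_prop)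
    refine DifferentiableAt.clog ?_ hsl
    exact (DifferentiableAt.fun_inv (h := fun z : ℂ => z + (k : ℂ)) (by fun_prop) hz0).const_add 1
  · rintro k z ⟨h1, h2⟩
    have hk : (0 : ℝ) ≤ k := Nat.cast_nonneg k
    have hn2 : ‖z + k‖ ^ 2 = (z.re + k) ^ 2 + z.im ^ 2 := by
      rw [Complex.sq_norm, Complex.normSq_apply]; simp; ring
    have hn : 3 / 2 ≤ ‖z + k‖ := by
      refine le_trans h2.le (le_trans (le_abs_self _) ?_)
      simpa using Complex.abs_im_le_norm (z + k)
    refine (norm_binetTerm_le hn).trans ?_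
    rw [hn2, div_mul_eq_mul_div, div_le_div_iff₀ (by positivity) (by positivity)]
    nlinarith [sq_nonneg ((k : ℝ) - 1), mul_nonneg h1.le hk]

/-- Cauchy's estimate on the circle of radius 1/4, which accounts for the factor 4 over
`norm_binetSum_le`. -/
lemma norm_deriv_binetSum_le {z : ℂ} (hre : 1 / 2 ≤ z.re) (him : 2 ≤ z.im) :
    ‖deriv binetSum z‖ ≤ 64 / 5 / (z.im - 1 / 2) := by
  have key : ∀ u ∈ Metric.closedBall z (1 / 4), 1 / 4 ≤ u.re ∧ z.im - 1 / 4 ≤ u.im := by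
    intro u hu
    rw [Metric.mem_closedBall, dist_eq_norm] at hu
    have h1 := (abs_le.1 ((Complex.abs_re_le_norm (u - z)).trans hu)).1
    have h2 := (abs_le.1 ((Complex.abs_im_le_norm (u - z)).trans hu)).1
    simp at h1 h2
    constructor <;> linarith
  have hsub : Metric.closedBall z (1 / 4) ⊆ {z : ℂ | 0 < z.re ∧ 3 / 2 < z.im} := by
    intro u hu
    have := key u hu
    constructor <;> linarith [this.1, this.2]
  have hd : DiffContOnCl ℂ binetSum (Metric.ball z (1 / 4)) := by
    refine ⟨differentiableOn_binetSum.mono (Metric.ball_subset_closedBall.trans hsub), ?_⟩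
    rw [closure_ball z (by norm_num)]
    exact (differentiableOn_binetSum.mono hsub).continuousOn
  have := Complex.norm_deriv_le_of_forall_mem_sphere_norm_le (C := 16 / 5 / (z.im - 1 / 2))
    (by norm_num) hd (fun u hu => by
      have hk := key u (Metric.sphere_subset_closedBall hu)
      refine (norm_binetSum_le (by linarith [hk.1]) (by linarith [hk.2])).trans ?_
      apply div_le_div_of_nonneg_left (by norm_num) (by linarith) (by linarith [hk.1, hk.2]))
  refine this.trans (le_of_eq ?_)
  field_simp; norm_num

lemma add_natCast_ne_zero_of_re_pos {z : ℂ} (hz : 0 < z.re) (k : ℕ) : z + k ≠ 0 := by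
  intro h
  have := congrArg Complex.re h
  simp at this
  have hk : (0 : ℝ) ≤ k := Nat.cast_nonneg k
  linarith

/-- Both z and 1 + 1/z have argument in (-π/2, π/2), so the sum of the arguments stays on the
principal branch. -/
lemma log_add_one_of_re_pos {z : ℂ} (hz : 0 < z.re) :
    Complex.log (z + 1) = Complex.log z + Complex.log (1 + z⁻¹) := by
  have hz0 : z ≠ 0 := by simpa using add_natCast_ne_zero_of_re_pos hz 0
  have h1 : 0 < (1 + z⁻¹).re := by
    have : 0 < (z⁻¹).re := by
      rw [Complex.inv_re]; exact div_pos hz (Complex.normSq_pos.2 hz0)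
    simp only [Complex.add_re, Complex.one_re]; linarith
  have h10 : 1 + z⁻¹ ≠ 0 := by intro h; rw [h] at h1; simp at h1
  have e : z + 1 = z * (1 + z⁻¹) := by field_simp
  rw [e, Complex.log_mul_eq_add_log_iff hz0 h10]
  have a1 := abs_lt.1 (Complex.abs_arg_lt_pi_div_two_iff.2 (Or.inl hz))
  have a2 := abs_lt.1 (Complex.abs_arg_lt_pi_div_two_iff.2 (Or.inl h1))
  constructor <;> linarith [a1.1, a1.2, a2.1, a2.2]

lemma stirlingMain_add_one {z : ℂ} (hz : 0 < z.re) :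
    stirlingMain (z + 1) = stirlingMain z + Complex.log z + binetTerm z := by
  simp only [stirlingMain, binetTerm, log_add_one_of_re_pos hz]
  ring

lemma prod_add_natCast_eq_exp {z : ℂ} (hz : 0 < z.re) (N : ℕ) :
    ∏ j ∈ Finset.range N, (z + j) = Complex.exp (stirlingMain (z + N) - stirlingMain z
      - ∑ j ∈ Finset.range N, binetTerm (z + j)) := by
  induction N with
  | zero => simp
  | succ N ih =>
    have hre : 0 < (z + N).re := by simp; positivity
    have hne := add_natCast_ne_zero_of_re_pos hz N
    have e : z + (N + 1 : ℕ) = z + N + 1 := by push_cast; ring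
    rw [Finset.prod_range_succ, ih, Finset.sum_range_succ, e, stirlingMain_add_one hre]
    nth_rewrite 2 [← Complex.exp_log hne]
    rw [← Complex.exp_add]
    congr 1; ring

/-- Stirling's formula for N! supplies the constant √(2π); the rest is the limit (N + z + 1/2) log(1
+ (z + 1)/N) → z + 1. -/
lemma tendsto_cpow_mul_factorial_mul_exp {z : ℂ} (hz : 0 < z.re) :
    Tendsto (fun N : ℕ => (N : ℂ) ^ z * (N.factorial : ℂ)
      * Complex.exp (-stirlingMain (z + (N + 1 : ℕ)))) atTop (𝓝 (√(2 * Real.pi) : ℝ)) := by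
  have hg : Tendsto (fun N : ℕ => (N : ℂ) * ((z + 1) / N)) atTop (𝓝 (z + 1)) := by
    refine tendsto_const_nhds.congr' ?_
    filter_upwards [eventually_ne_atTop 0] with N hN
    have : (N : ℂ) ≠ 0 := Nat.cast_ne_zero.2 hN
    field_simp
  have hl := Complex.tendsto_nat_mul_log_one_add_of_tendsto hg
  have hinv : Tendsto (fun N : ℕ => ((N : ℂ))⁻¹) atTop (𝓝 0) :=
    tendsto_inv_atTop_nhds_zero_nat (𝕜 := ℂ)
  have hl0 : Tendsto (fun N : ℕ => Complex.log (1 + (z + 1) / N)) atTop (𝓝 0) := by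
    have := hinv.mul hl
    rw [zero_mul] at this
    refine this.congr' ?_
    filter_upwards [eventually_ne_atTop 0] with N hN
    have : (N : ℂ) ≠ 0 := Nat.cast_ne_zero.2 hN
    field_simp
  have hE : Tendsto (fun N : ℕ => Complex.exp (z + 1 - (N * Complex.log (1 + (z + 1) / N)
      + (z + 1 / 2) * Complex.log (1 + (z + 1) / N)))) atTop (𝓝 1) := by
    have := (tendsto_const_nhds (x := z + 1)).sub (hl.add (hl0.const_mul (z + 1 / 2)))
    have := (Complex.continuous_exp.tendsto _).comp this
    simpa [Function.comp_def] using this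
  have hS : Tendsto (fun N : ℕ => ((Stirling.stirlingSeq N * √2 : ℝ) : ℂ)) atTop
      (𝓝 (√(2 * Real.pi) : ℝ)) := by
    have := (Stirling.tendsto_stirlingSeq_sqrt_pi.mul_const √2)
    rw [show √Real.pi * √2 = √(2 * Real.pi) by
      rw [mul_comm, Real.sqrt_mul (by norm_num)]] at this
    exact (Complex.continuous_ofReal.tendsto _).comp this
  have := hS.mul hE
  rw [mul_one] at this
  refine this.congr' ?_
  filter_upwards [eventually_ne_atTop 0] with N hN
  have hNC : (N : ℂ) ≠ 0 := Nat.cast_ne_zero.2 hN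
  have hNR : (0 : ℝ) < N := Nat.cast_pos.2 (Nat.pos_of_ne_zero hN)
  have hfac : (N.factorial : ℝ) = Stirling.stirlingSeq N * √2
      * Real.exp (1 / 2 * Real.log N + N * Real.log N - N) := by
    have h1 : Real.exp (1 / 2 * Real.log N + N * Real.log N - N)
        = √N * (N / Real.exp 1) ^ N := by
      rw [Real.exp_sub, Real.exp_add, div_pow, ← Real.exp_nat_mul, mul_one, mul_div_assoc]
      congr 1
      · rw [Real.sqrt_eq_rpow, Real.rpow_def_of_pos hNR]; ring_nf
      · congr 1
        rw [Real.exp_nat_mul, Real.exp_log hNR]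
    rw [h1, Stirling.stirlingSeq, Real.sqrt_mul (by norm_num)]
    have : √(N : ℝ) ≠ 0 := (Real.sqrt_pos.2 hNR).ne'
    have : (N : ℝ) / Real.exp 1 ≠ 0 := by positivity
    field_simp
  have hfacC : (N.factorial : ℂ) = ((Stirling.stirlingSeq N * √2 : ℝ) : ℂ)
      * Complex.exp (1 / 2 * Complex.log N + N * Complex.log N - N) := by
    have := congrArg (fun x : ℝ => (x : ℂ)) hfac
    push_cast at this ⊢
    exact this
  have hlog : Complex.log (z + (N + 1 : ℕ))
      = Complex.log N + Complex.log (1 + (z + 1) / N) := by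
    have e : z + (N + 1 : ℕ) = ((N : ℝ) : ℂ) * (1 + (z + 1) / N) := by
      push_cast; field_simp; ring
    have hre : (1 + (z + 1) / N) ≠ 0 := by
      intro h
      rw [h, mul_zero] at e
      exact add_natCast_ne_zero_of_re_pos hz _ e
    rw [e, Complex.log_ofReal_mul hNR hre, Complex.ofReal_log hNR.le]; simp
  rw [hfacC, Complex.cpow_def_of_ne_zero hNC, stirlingMain, hlog]
  rw [mul_comm (Complex.exp _) (_ * _), mul_assoc, mul_assoc, ← Complex.exp_add, ← Complex.exp_add]
  congr 2
  push_cast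
  ring

/-- In Euler's limit N^z N!/(z(z + 1)⋯(z + N)) the denominator is an exponential of a telescoping
sum plus the partial sums of Binet's series. -/
theorem Gamma_eq_exp_stirlingMain {z : ℂ} (hre : 0 < z.re) (him : 3 / 2 ≤ z.im) :
    Complex.Gamma z = (√(2 * Real.pi) : ℝ) * Complex.exp (stirlingMain z + binetSum z) := by
  refine tendsto_nhds_unique (Complex.GammaSeq_tendsto_Gamma z) ?_
  have hs := ((summable_binetTerm hre him).hasSum.tendsto_sum_nat.comp (tendsto_add_atTop_nat 1))
  have h2 := (Complex.continuous_exp.tendsto _).comp (hs.const_add (stirlingMain z))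
  refine ((tendsto_cpow_mul_factorial_mul_exp hre).mul h2).congr fun N => ?_
  rw [Complex.GammaSeq, prod_add_natCast_eq_exp hre, div_eq_mul_inv, ← Complex.exp_neg, mul_assoc]
  simp only [Function.comp]
  rw [← Complex.exp_add]
  congr 2
  ring

lemma hasDerivAt_stirlingMain {z : ℂ} (hre : 0 < z.re) :
    HasDerivAt stirlingMain (Complex.log z - 1 / (2 * z)) z := by
  have hz0 : z ≠ 0 := by simpa using add_natCast_ne_zero_of_re_pos hre 0
  have h := (((hasDerivAt_id z).sub_const (1 / 2)).mul
    (Complex.hasDerivAt_log (Or.inl hre))).sub (hasDerivAt_id z)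
  convert! h using 1
  simp only [id]
  field_simp
  ring

theorem hasDerivAt_Gamma_of_im_gt {z : ℂ} (hre : 0 < z.re) (him : 3 / 2 < z.im) :
    HasDerivAt Complex.Gamma
      (Complex.Gamma z * (Complex.log z - 1 / (2 * z) + deriv binetSum z)) z := by
  have hmem : {z : ℂ | 0 < z.re ∧ 3 / 2 < z.im} ∈ 𝓝 z :=
    isOpen_re_pos_im_gt.mem_nhds ⟨hre, him⟩
  have hb : HasDerivAt binetSum (deriv binetSum z) z :=
    (differentiableOn_binetSum.differentiableAt hmem).hasDerivAt
  have h := (((hasDerivAt_stirlingMain hre).add hb).cexp).const_mul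
    ((√(2 * Real.pi) : ℝ) : ℂ)
  rw [Gamma_eq_exp_stirlingMain hre him.le, mul_assoc]
  refine h.congr_of_eventuallyEq ?_
  filter_upwards [hmem] with u hu
  exact Gamma_eq_exp_stirlingMain hu.1 hu.2.le

/-! ### Stationary phase by integration by parts -/

/-- Integration by parts with a multiplier h for which (hF)' is close to iF: the boundary terms come
from hF, and B' dominates the defect (hF)' - iF. -/
lemma norm_intervalIntegral_le_of_multiplier {F F' : ℝ → ℂ} {h h' B B' : ℝ → ℝ} {a b : ℝ}
    (hab : a ≤ b) (hFc : Continuous F)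
    (hF : ∀ t ∈ Set.Icc a b, HasDerivAt F (F' t) t)
    (hh : ∀ t ∈ Set.Icc a b, HasDerivAt h (h' t) t)
    (hB : ∀ t ∈ Set.Icc a b, HasDerivAt B (B' t) t)
    (hle : ∀ t ∈ Set.Icc a b, ‖(h' t : ℂ) * F t + h t * F' t - Complex.I * F t‖ ≤ B' t) :
    ‖∫ t in a..b, F t‖ ≤ |h a| * ‖F a‖ + |h b| * ‖F b‖ + (B b - B a) := by
  set W : ℝ → ℂ := fun t => (h t : ℂ) * F t - h a * F a - Complex.I * ∫ u in a..t, F u with hW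
  have hWd : ∀ t ∈ Set.Icc a b,
      HasDerivAt W ((h' t : ℂ) * F t + h t * F' t - Complex.I * F t) t := by
    intro t ht
    have h1 := ((hh t ht).ofReal_comp.mul (hF t ht)).sub_const ((h a : ℂ) * F a)
    have h2 := (intervalIntegral.integral_hasDerivAt_right (hFc.intervalIntegrable a t)
      (hFc.stronglyMeasurableAtFilter _ _) hFc.continuousAt).const_mul Complex.I
    exact h1.sub h2
  have key : ‖W b‖ ≤ B b - B a := by
    refine image_norm_le_of_norm_deriv_right_le_deriv_boundary' (f := W) (a := a) (b := b)
      (B := fun t => B t - B a) (B' := B')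
      (fun t ht => (hWd t ht).continuousAt.continuousWithinAt)
      (fun t ht => (hWd t ⟨ht.1, ht.2.le⟩).hasDerivWithinAt) ?_
      (fun t ht => ((hB t ht).sub_const _).continuousAt.continuousWithinAt)
      (fun t ht => ((hB t ⟨ht.1, ht.2.le⟩).sub_const _).hasDerivWithinAt)
      (fun t ht => hle t ⟨ht.1, ht.2.le⟩) ⟨hab, le_rfl⟩
    simp [hW]
  have e : ∫ t in a..b, F t = Complex.I * (W b - h b * F b + h a * F a) := by
    simp only [hW]
    linear_combination (∫ t in a..b, F t) * Complex.I_sq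
  rw [e, norm_mul, Complex.norm_I, one_mul]
  have := norm_add₃_le (a := W b) (b := -((h b : ℂ) * F b)) (c := (h a : ℂ) * F a)
  rw [← sub_eq_add_neg, norm_neg, norm_mul, norm_mul, Complex.norm_real, Complex.norm_real,
    Real.norm_eq_abs, Real.norm_eq_abs] at this
  linarith

section Oscillatory

variable {F e : ℝ → ℂ} {N t₀ A E : ℝ}

lemma hasDerivAt_mul_log_div (ht₀ : 0 < t₀) {t : ℝ} (ht : 0 < t) :
    HasDerivAt (fun t => N * Real.log (t / t₀)) (N / t) t := by
  have h := (((hasDerivAt_id t).div_const t₀).log (div_pos ht ht₀).ne').const_mul N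
  convert! h using 1
  simp only [id]
  field_simp

/-- Away from the stationary point `t₀` of the phase. -/
lemma norm_integral_le_of_log_two_le (hN : 1 ≤ N) (ht₀ : 0 < t₀) (hA : 0 ≤ A) (hE : 0 ≤ E)
    (hFc : Continuous F)
    (hF : ∀ t, 2 ≤ t →
      HasDerivAt F (F t * (Complex.I * ((N * Real.log (t / t₀) : ℝ) : ℂ) + e t)) t)
    (hFA : ∀ t, 2 ≤ t → ‖F t‖ ≤ A / √t) (he : ∀ t, 2 ≤ t → ‖e t‖ ≤ E * N / t)
    {a b : ℝ} (ha : 2 ≤ a) (hab : a ≤ b)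
    (hlog : ∀ t ∈ Set.Icc a b, Real.log 2 ≤ |Real.log (t / t₀)|) :
    ‖∫ t in a..b, F t‖ ≤ A * (6 + 9 / 4 * E) := by
  have hL : (0.69 : ℝ) ≤ Real.log 2 := by linarith [Real.log_two_gt_d9]
  set p : ℝ → ℝ := fun t => N * Real.log (t / t₀) with hp
  have hpl : ∀ t ∈ Set.Icc a b, N * 0.69 ≤ |p t| := by
    intro t ht
    rw [hp]; simp only
    rw [abs_mul, abs_of_pos (by linarith : 0 < N)]
    have := hlog t ht
    gcongr; linarith
  have hp0 : ∀ t ∈ Set.Icc a b, p t ≠ 0 := by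
    intro t ht h0
    have := hpl t ht
    rw [h0, abs_zero] at this
    linarith
  set C : ℝ := A * (2.11 + 1.45 * E) with hC
  have hC0 : 0 ≤ C := by positivity
  have hsa : 1.414 ≤ √a := Real.le_sqrt_of_sq_le (by norm_num; linarith)
  have bdry : ∀ t ∈ Set.Icc a b, |(p t)⁻¹| * ‖F t‖ ≤ 1.03 * A := by
    intro t ht
    have hst : 1.414 ≤ √t := Real.le_sqrt_of_sq_le (by norm_num; linarith [ht.1])
    have h1 : |(p t)⁻¹| ≤ 1 / 0.69 := by
      rw [abs_inv, inv_eq_one_div]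
      exact one_div_le_one_div_of_le (by norm_num) (by linarith [hpl t ht])
    have h2 : ‖F t‖ ≤ A / 1.414 := (hFA t (by linarith [ht.1])).trans (by gcongr)
    calc |(p t)⁻¹| * ‖F t‖ ≤ 1 / 0.69 * (A / 1.414) := by gcongr
      _ = (1 / 0.69 * (1 / 1.414)) * A := by ring
      _ ≤ 1.03 * A := by gcongr; norm_num
  -- With h = 1/p the defect is F·(h' + h·e), of order t^(-3/2), and -2C/√t is an antiderivative of
  -- the majorant C/(t√t).
  have main := norm_intervalIntegral_le_of_multiplier (h := fun t => (p t)⁻¹)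
    (h' := fun t => -(N / t) / p t ^ 2) (B := fun t => -(2 * C) * (√t)⁻¹)
    (B' := fun t => C / (t * √t)) hab hFc (fun t ht => hF t (ha.trans ht.1))
    (fun t ht => (hasDerivAt_mul_log_div ht₀ (by linarith [ht.1])).inv (hp0 t ht))
    (fun t ht => by
      have ht0 : 0 < t := by linarith [ht.1]
      have hs : √t ≠ 0 := (Real.sqrt_pos.2 ht0).ne'
      have h := ((Real.hasDerivAt_sqrt ht0.ne').inv hs).const_mul (-(2 * C))
      convert! h using 1
      rw [Real.sq_sqrt ht0.le]
      field_simp)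
    (fun t ht => by
      have ht0 : 0 < t := by linarith [ht.1]
      have hpC : (p t : ℂ) ≠ 0 := by exact_mod_cast hp0 t ht
      have e1 : ((-(N / t) / p t ^ 2 : ℝ) : ℂ) * F t
          + ((p t)⁻¹ : ℝ) * (F t * (Complex.I * ((N * Real.log (t / t₀) : ℝ) : ℂ) + e t))
          - Complex.I * F t = F t * (((-(N / t) / p t ^ 2 : ℝ) : ℂ) + ((p t)⁻¹ : ℝ) * e t) := by
        have : ((N * Real.log (t / t₀) : ℝ) : ℂ) = (p t : ℂ) := rfl
        rw [this, Complex.ofReal_inv]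
        field_simp
        ring
      rw [e1, norm_mul]
      have hst := Real.sqrt_pos.2 ht0
      have hpp := hpl t ht
      have hpos : 0 < |p t| := by linarith
      have b1 : ‖((-(N / t) / p t ^ 2 : ℝ) : ℂ)‖ ≤ 2.11 / t := by
        rw [Complex.norm_real, Real.norm_eq_abs, abs_div, abs_neg, abs_of_pos (by positivity),
          abs_pow, div_le_div_iff₀ (by positivity) ht0, div_mul_cancel₀ _ ht0.ne']
        have : (N * 0.69) ^ 2 ≤ |p t| ^ 2 := by gcongr
        nlinarith
      have b2 : ‖(((p t)⁻¹ : ℝ) : ℂ) * e t‖ ≤ 1.45 * E / t := by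
        rw [norm_mul, Complex.norm_real, Real.norm_eq_abs, abs_inv]
        have h1 : |p t|⁻¹ ≤ (N * 0.69)⁻¹ := inv_anti₀ (by positivity) hpp
        calc |p t|⁻¹ * ‖e t‖ ≤ (N * 0.69)⁻¹ * (E * N / t) := by
              gcongr; exact he t (by linarith [ht.1])
          _ = (1 / 0.69) * E / t := by field_simp
          _ ≤ 1.45 * E / t := by gcongr; norm_num
      calc ‖F t‖ * ‖((-(N / t) / p t ^ 2 : ℝ) : ℂ) + ((p t)⁻¹ : ℝ) * e t‖
          ≤ A / √t * (2.11 / t + 1.45 * E / t) := by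
            gcongr
            · exact hFA t (by linarith [ht.1])
            · exact (norm_add_le _ _).trans (add_le_add b1 b2)
        _ = C / (t * √t) := by rw [hC]; field_simp)
  refine main.trans ?_
  have ba := bdry a ⟨le_rfl, hab⟩
  have bb := bdry b ⟨hab, le_rfl⟩
  have : (√a)⁻¹ ≤ 1 / 1.414 := by
    rw [inv_eq_one_div]; exact one_div_le_one_div_of_le (by norm_num) hsa
  have h3 : 2 * C * (√a)⁻¹ ≤ 2 * C * (1 / 1.414) := by gcongr
  have h4 : 0 ≤ 2 * C * (√b)⁻¹ := by positivity
  have h5 : 2 * C * (1 / 1.414) ≤ A * (2.99 + 9 / 4 * E) := by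
    rw [hC]; nlinarith [mul_nonneg hA hE]
  nlinarith

lemma hasDerivAt_div_sq_add_sq {p : ℝ → ℝ} {p' ε t : ℝ} (hp : HasDerivAt p p' t) (hε : 0 < ε) :
    HasDerivAt (fun t => p t / (p t ^ 2 + ε ^ 2))
      (p' * (ε ^ 2 - p t ^ 2) / (p t ^ 2 + ε ^ 2) ^ 2) t := by
  have hq : p t ^ 2 + ε ^ 2 ≠ 0 := by positivity
  have h := hp.div ((hp.pow 2).add_const (ε ^ 2)) hq
  convert! h using 2
  simp only [Pi.pow_apply]
  push_cast
  ring

lemma hasDerivAt_arctan_div {p : ℝ → ℝ} {p' ε t : ℝ} (hp : HasDerivAt p p' t) (hε : 0 < ε) :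
    HasDerivAt (fun t => 1 / ε * Real.arctan (p t / ε)) (p' / (p t ^ 2 + ε ^ 2)) t := by
  have h := ((hp.div_const ε).arctan).const_mul (1 / ε)
  convert! h using 1
  have h5 : 1 + (p t / ε) ^ 2 = (p t ^ 2 + ε ^ 2) / ε ^ 2 := by field_simp; ring
  rw [h5]
  field_simp

lemma abs_div_sq_add_sq_le (P : ℝ) {ε : ℝ} (hε : 0 < ε) : |P / (P ^ 2 + ε ^ 2)| ≤ 1 / (2 * ε) := by
  have hq : 0 < P ^ 2 + ε ^ 2 := by positivity
  rw [abs_div, abs_of_pos hq, div_le_div_iff₀ hq (by positivity)]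
  nlinarith [sq_nonneg (|P| - ε), sq_abs P]

/-- `P / (P ^ 2 + ε ^ 2)` regularizes the multiplier 1/P, which is singular at the stationary point.
Its derivative and the new defect ε²/(P² + ε²) are both bounded by multiples of p'/(P² + ε²), whose
primitive is an arctangent varying by at most π/ε. -/
lemma norm_multiplier_deriv_le {z w : ℂ} {P p' ε E A : ℝ} (hε : 0 < ε) (hz : ‖z‖ ≤ A)
    (hw : ‖w‖ ≤ 2 * E * ε ^ 2) (hp' : ε ^ 2 ≤ 2 * p') :
    ‖((p' * (ε ^ 2 - P ^ 2) / (P ^ 2 + ε ^ 2) ^ 2 : ℝ) : ℂ) * z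
      + ((P / (P ^ 2 + ε ^ 2) : ℝ) : ℂ) * (z * (Complex.I * (P : ℂ) + w)) - Complex.I * z‖
      ≤ A * (3 * (p' / (P ^ 2 + ε ^ 2)) + E * ε) := by
  have hq : 0 < P ^ 2 + ε ^ 2 := by positivity
  have hp0 : 0 < p' := by nlinarith [pow_pos hε 2]
  have hA : 0 ≤ A := (norm_nonneg _).trans hz
  set d : ℝ := p' * (ε ^ 2 - P ^ 2) / (P ^ 2 + ε ^ 2) ^ 2 with hd
  set k : ℝ := P / (P ^ 2 + ε ^ 2) with hk
  have e1 : (d : ℂ) * z + (k : ℂ) * (z * (Complex.I * (P : ℂ) + w)) - Complex.I * z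
      = z * ((d : ℂ) + (k : ℂ) * w + (-(ε ^ 2 / (P ^ 2 + ε ^ 2)) : ℝ) * Complex.I) := by
    have h7 : k * P = 1 - ε ^ 2 / (P ^ 2 + ε ^ 2) := by
      rw [hk]; field_simp; ring
    have h8 : (k : ℂ) * P = 1 - ((ε ^ 2 / (P ^ 2 + ε ^ 2) : ℝ) : ℂ) := by
      exact_mod_cast h7
    push_cast at h8 ⊢
    linear_combination z * Complex.I * h8
  rw [e1, norm_mul]
  have b1 : ‖(d : ℂ)‖ ≤ p' / (P ^ 2 + ε ^ 2) := by
    have h1 : |ε ^ 2 - P ^ 2| ≤ P ^ 2 + ε ^ 2 := by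
      rw [abs_le]
      constructor <;> nlinarith [sq_nonneg P, sq_nonneg ε]
    rw [Complex.norm_real, Real.norm_eq_abs, hd, abs_div, abs_of_pos (pow_pos hq 2),
      abs_mul, abs_of_pos hp0]
    calc p' * |ε ^ 2 - P ^ 2| / (P ^ 2 + ε ^ 2) ^ 2
        ≤ p' * (P ^ 2 + ε ^ 2) / (P ^ 2 + ε ^ 2) ^ 2 := by gcongr
      _ = _ := by field_simp
  have b2 : ‖(k : ℂ) * w‖ ≤ E * ε := by
    rw [norm_mul, Complex.norm_real, Real.norm_eq_abs]
    calc |k| * ‖w‖ ≤ 1 / (2 * ε) * (2 * E * ε ^ 2) := by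
          gcongr
          exact abs_div_sq_add_sq_le P hε
      _ = E * ε := by field_simp
  have b3 : ‖((-(ε ^ 2 / (P ^ 2 + ε ^ 2)) : ℝ) : ℂ) * Complex.I‖
      ≤ 2 * (p' / (P ^ 2 + ε ^ 2)) := by
    rw [norm_mul, Complex.norm_I, mul_one, Complex.norm_real, Real.norm_eq_abs, abs_neg,
      abs_of_pos (div_pos (by positivity) hq), mul_div_assoc']
    exact div_le_div_of_nonneg_right hp' hq.le
  have b4 := norm_add₃_le (a := (d : ℂ)) (b := (k : ℂ) * w)
    (c := ((-(ε ^ 2 / (P ^ 2 + ε ^ 2)) : ℝ) : ℂ) * Complex.I)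
  refine mul_le_mul hz ?_ (norm_nonneg _) hA
  linarith

/-- Near the stationary point `t₀` of the phase. -/
lemma norm_integral_le_near_stationary (hN : 1 ≤ N) (ht₀ : 0 < t₀) (hA : 0 ≤ A) (hE : 0 ≤ E)
    (hFc : Continuous F)
    (hF : ∀ t, 2 ≤ t →
      HasDerivAt F (F t * (Complex.I * ((N * Real.log (t / t₀) : ℝ) : ℂ) + e t)) t)
    (hFA : ∀ t, 2 ≤ t → ‖F t‖ ≤ A / √t) (he : ∀ t, 2 ≤ t → ‖e t‖ ≤ E * N / t)
    {a b : ℝ} (ha : 2 ≤ a) (hab : a ≤ b) (h1 : t₀ / 2 ≤ a) (h2 : b ≤ 2 * t₀) :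
    ‖∫ t in a..b, F t‖ ≤ A * (15 + 9 / 4 * E) * √N := by
  set p : ℝ → ℝ := fun t => N * Real.log (t / t₀) with hp
  -- ε² is the derivative of the phase derivative at t₀, so ε² ≤ 2N/t as long as t ≤ 2t₀.
  set ε : ℝ := √N / √t₀ with hε
  have hN0 : 0 < N := by linarith
  have hsN : 0 < √N := Real.sqrt_pos.2 hN0
  have hst : 0 < √t₀ := Real.sqrt_pos.2 ht₀
  have hε0 : 0 < ε := by positivity
  have hε2 : ε ^ 2 = N / t₀ := by
    rw [hε, div_pow, Real.sq_sqrt hN0.le, Real.sq_sqrt ht₀.le]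
  set A' : ℝ := 1.4143 * A / √t₀ with hA'
  have hA0 : 0 ≤ A' := by positivity
  -- Here t ≥ t₀/2, and 1.4143 exceeds √2.
  have hF' : ∀ t ∈ Set.Icc a b, ‖F t‖ ≤ A' := by
    intro t ht
    have ht0 : 0 < t := by linarith [ht.1]
    refine (hFA t (by linarith [ht.1])).trans ?_
    have hs : √t₀ ≤ 1.4143 * √t := by
      rw [show (1.4143 : ℝ) = √(1.4143 ^ 2) by rw [Real.sqrt_sq (by norm_num)],
        ← Real.sqrt_mul (by norm_num)]
      apply Real.sqrt_le_sqrt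
      nlinarith [ht.1]
    rw [hA', div_le_div_iff₀ (Real.sqrt_pos.2 ht0) hst]
    nlinarith
  have hpd : ∀ t ∈ Set.Icc a b, HasDerivAt p (N / t) t := fun t ht =>
    hasDerivAt_mul_log_div (N := N) ht₀ (by linarith [ht.1])
  have main := norm_intervalIntegral_le_of_multiplier
    (B := fun t => A' * (3 * (1 / ε * Real.arctan (p t / ε)) + E * ε * t))
    (B' := fun t => A' * (3 * (N / t / (p t ^ 2 + ε ^ 2)) + E * ε))
    hab hFc (fun t ht => hF t (ha.trans ht.1))
    (fun t ht => hasDerivAt_div_sq_add_sq (hpd t ht) hε0)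
    (fun t ht => by
      have h := (((hasDerivAt_arctan_div (hpd t ht) hε0).const_mul 3).add
        ((hasDerivAt_id t).const_mul (E * ε))).const_mul A'
      rwa [mul_one] at h)
    (fun t ht => by
      have ht0 : 0 < t := by linarith [ht.1]
      refine norm_multiplier_deriv_le hε0 (hF' t ht) ?_ ?_
      · refine (he t (by linarith [ht.1])).trans ?_
        rw [hε2, mul_div_assoc', div_le_div_iff₀ ht0 ht₀]
        have : 0 ≤ E * N := by positivity
        nlinarith [ht.1]
      · rw [hε2, mul_div_assoc', div_le_div_iff₀ ht₀ ht0]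
        nlinarith [ht.2])
  refine main.trans ?_
  have ba : |p a / (p a ^ 2 + ε ^ 2)| * ‖F a‖ ≤ 1 / (2 * ε) * A' := by
    gcongr
    · exact abs_div_sq_add_sq_le _ hε0
    · exact hF' a ⟨le_rfl, hab⟩
  have bb : |p b / (p b ^ 2 + ε ^ 2)| * ‖F b‖ ≤ 1 / (2 * ε) * A' := by
    gcongr
    · exact abs_div_sq_add_sq_le _ hε0
    · exact hF' b ⟨hab, le_rfl⟩
  have harc : Real.arctan (p b / ε) - Real.arctan (p a / ε) ≤ 3.1416 := by
    have := Real.arctan_lt_pi_div_two (p b / ε)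
    have := Real.neg_pi_div_two_lt_arctan (p a / ε)
    linarith [Real.pi_lt_d4]
  have hE1 : A' * (3 * (1 / ε * Real.arctan (p b / ε)) + E * ε * b)
      - A' * (3 * (1 / ε * Real.arctan (p a / ε)) + E * ε * a)
      ≤ A' * (3 / ε * 3.1416 + E * ε * (3 / 2 * t₀)) := by
    rw [← mul_sub]
    refine mul_le_mul_of_nonneg_left ?_ hA0
    have q1 : 3 / ε * (Real.arctan (p b / ε) - Real.arctan (p a / ε)) ≤ 3 / ε * 3.1416 := by gcongr
    have q2 : E * ε * (b - a) ≤ E * ε * (3 / 2 * t₀) := by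
      gcongr; linarith
    have q3 : 3 * (1 / ε * Real.arctan (p b / ε)) - 3 * (1 / ε * Real.arctan (p a / ε))
      = 3 / ε * (Real.arctan (p b / ε) - Real.arctan (p a / ε)) := by ring
    linarith
  have r1 : A' / ε = 1.4143 * A / √N := by
    rw [hA', hε]; field_simp
  have r2 : A' * ε * t₀ = 1.4143 * A * √N := by
    rw [hA', hε]
    have : √t₀ * √t₀ = t₀ := Real.mul_self_sqrt ht₀.le
    field_simp
    rw [pow_two, this]
  have r3 : A' / ε ≤ 1.4143 * A * √N := by
    rw [r1]
    have : 1 ≤ √N := Real.one_le_sqrt.2 hN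
    rw [div_le_iff₀ hsN]
    have : 1.4143 * A * 1 ≤ 1.4143 * A * (√N * √N) := by
      gcongr; nlinarith
    linarith
  have r4 : 1 / (2 * ε) * A' = 1 / 2 * (A' / ε) := by field_simp
  have r5 : A' * (3 / ε * 3.1416 + E * ε * (3 / 2 * t₀))
      = 9.4248 * (A' / ε) + 3 / 2 * E * (A' * ε * t₀) := by field_simp; ring
  rw [r4] at ba bb
  rw [r5, r2] at hE1
  have : 0 ≤ A * √N := by positivity
  nlinarith [mul_nonneg this hE]

/-- A stationary phase estimate: the amplitude decays like `t ^ (-1/2)` and the phase has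
derivative `N log (t / t₀)` up to `O(N / t)`; the bound is uniform in the endpoint. -/
theorem norm_integral_le_of_stationary_phase (hN : 1 ≤ N) (ht₀ : 0 < t₀) (hA : 0 ≤ A) (hE : 0 ≤ E)
    (hFc : Continuous F)
    (hF : ∀ t, 2 ≤ t →
      HasDerivAt F (F t * (Complex.I * ((N * Real.log (t / t₀) : ℝ) : ℂ) + e t)) t)
    (hFA : ∀ t, 2 ≤ t → ‖F t‖ ≤ A / √t) (he : ∀ t, 2 ≤ t → ‖e t‖ ≤ E * N / t)
    {T : ℝ} (hT : 2 ≤ T) :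
    ‖∫ t in (2 : ℝ)..T, F t‖ ≤ A * (27 + 27 / 4 * E) * √N := by
  have hAE : 0 ≤ A * E := mul_nonneg hA hE
  have hsN : 1 ≤ √N := Real.one_le_sqrt.2 hN
  -- The cut points t₀/2 and 2t₀ are clamped to [2, T], so any of the three ranges may be
  -- degenerate.
  set m₁ := max 2 (min T (t₀ / 2)) with hm₁
  set m₂ := max 2 (min T (2 * t₀)) with hm₂
  have h12 : m₁ ≤ m₂ := max_le_max le_rfl (min_le_min le_rfl (by linarith))
  have h2 : 2 ≤ m₁ := le_max_left _ _
  have h2T : m₂ ≤ T := max_le hT (min_le_left _ _)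
  have hi : ∀ x y, IntervalIntegrable F MeasureTheory.volume x y :=
    fun x y => hFc.intervalIntegrable x y
  have hsplit : ∫ t in (2 : ℝ)..T, F t
      = (∫ t in (2 : ℝ)..m₁, F t) + (∫ t in m₁..m₂, F t) + ∫ t in m₂..T, F t := by
    rw [intervalIntegral.integral_add_adjacent_intervals (hi _ _) (hi _ _),
      intervalIntegral.integral_add_adjacent_intervals (hi _ _) (hi _ _)]
  have i1 : ‖∫ t in (2 : ℝ)..m₁, F t‖ ≤ A * (6 + 9 / 4 * E) := by
    rcases eq_or_lt_of_le h2 with h | h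
    · rw [← h, intervalIntegral.integral_same, norm_zero]; positivity
    · refine norm_integral_le_of_log_two_le hN ht₀ hA hE hFc hF hFA he le_rfl h2 ?_
      intro t ht
      have hm : m₁ ≤ t₀ / 2 := by
        rcases max_choice 2 (min T (t₀ / 2)) with h' | h'
        · rw [hm₁, h'] at h; exact absurd h (lt_irrefl _)
        · rw [hm₁, h']; exact min_le_right _ _
      have ht0 : 0 < t := by linarith [ht.1]
      rw [← abs_neg, ← Real.log_inv, inv_div]
      refine le_trans (Real.log_le_log (by norm_num) ?_) (le_abs_self _)
      rw [le_div_iff₀ ht0]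
      linarith [ht.2]
  have i2 : ‖∫ t in m₁..m₂, F t‖ ≤ A * (15 + 9 / 4 * E) * √N := by
    rcases eq_or_lt_of_le h12 with h | h
    · rw [← h, intervalIntegral.integral_same, norm_zero]; positivity
    · refine norm_integral_le_near_stationary hN ht₀ hA hE hFc hF hFA he h2 h12 ?_ ?_
      · rcases le_total T (t₀ / 2) with h' | h'
        · rw [hm₁, min_eq_left h', max_eq_right hT] at h
          linarith
        · rw [hm₁, min_eq_right h']; exact le_max_right _ _
      · rcases max_choice 2 (min T (2 * t₀)) with h' | h'
        · rw [hm₂, h'] at h; linarith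
        · rw [hm₂, h']; exact min_le_right _ _
  have i3 : ‖∫ t in m₂..T, F t‖ ≤ A * (6 + 9 / 4 * E) := by
    rcases eq_or_lt_of_le h2T with h | h
    · rw [← h, intervalIntegral.integral_same, norm_zero]; positivity
    · refine norm_integral_le_of_log_two_le hN ht₀ hA hE hFc hF hFA he (h2.trans h12) h2T ?_
      intro t ht
      have hm : 2 * t₀ ≤ m₂ := by
        rcases le_total T (2 * t₀) with h' | h'
        · rw [hm₂, min_eq_left h', max_eq_right hT] at h
          exact absurd h (lt_irrefl _)
        · rw [hm₂, min_eq_right h']; exact le_max_right _ _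
      refine le_trans (Real.log_le_log (by norm_num) ?_) (le_abs_self _)
      rw [le_div_iff₀ ht₀]
      linarith [ht.1]
  have hb : A * (6 + 9 / 4 * E) ≤ A * (6 + 9 / 4 * E) * √N :=
    le_mul_of_one_le_right (by positivity) hsN
  rw [hsplit]
  refine (norm_add₃_le).trans ?_
  calc _ ≤ A * (6 + 9 / 4 * E) * √N + A * (15 + 9 / 4 * E) * √N + A * (6 + 9 / 4 * E) * √N := by
        linarith
    _ = _ := by ring

end Oscillatory

/-! ### Size and logarithmic derivative of the trigonometric factors -/

section TrigBounds

lemma norm_exp_mul_I_eq (w : ℂ) : ‖Complex.exp (w * Complex.I)‖ = Real.exp (-w.im) := by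
  rw [Complex.norm_exp]; simp

lemma norm_exp_neg_mul_I_eq (w : ℂ) : ‖Complex.exp (-w * Complex.I)‖ = Real.exp w.im := by
  rw [Complex.norm_exp]; simp

lemma norm_cos_le_exp (w : ℂ) : ‖Complex.cos w‖ ≤ Real.exp |w.im| := by
  have h := congrArg norm (Complex.two_cos w)
  rw [norm_mul, Complex.norm_ofNat] at h
  have h2 := norm_add_le (Complex.exp (w * Complex.I)) (Complex.exp (-w * Complex.I))
  rw [norm_exp_neg_mul_I_eq, norm_exp_mul_I_eq] at h2
  have h3 := Real.exp_le_exp.2 (le_abs_self w.im)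
  have h4 := Real.exp_le_exp.2 (neg_le_abs w.im)
  linarith

lemma norm_sin_le_exp (w : ℂ) : ‖Complex.sin w‖ ≤ Real.exp |w.im| := by
  have h := congrArg norm (Complex.two_sin w)
  rw [norm_mul, norm_mul, Complex.norm_I, Complex.norm_ofNat, mul_one] at h
  have h2 := norm_sub_le (Complex.exp (-w * Complex.I)) (Complex.exp (w * Complex.I))
  rw [norm_exp_neg_mul_I_eq, norm_exp_mul_I_eq] at h2
  have h3 := Real.exp_le_exp.2 (le_abs_self w.im)
  have h4 := Real.exp_le_exp.2 (neg_le_abs w.im)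
  linarith

lemma norm_cos_ge (w : ℂ) : (Real.exp w.im - Real.exp (-w.im)) / 2 ≤ ‖Complex.cos w‖ := by
  have h := congrArg norm (Complex.two_cos w)
  rw [norm_mul, Complex.norm_ofNat] at h
  have h2 := norm_sub_norm_le (Complex.exp (-w * Complex.I)) (-Complex.exp (w * Complex.I))
  rw [norm_neg, norm_exp_neg_mul_I_eq, norm_exp_mul_I_eq, sub_neg_eq_add, add_comm] at h2
  linarith

lemma norm_sin_ge (w : ℂ) : (Real.exp w.im - Real.exp (-w.im)) / 2 ≤ ‖Complex.sin w‖ := by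
  have h := congrArg norm (Complex.two_sin w)
  rw [norm_mul, norm_mul, Complex.norm_I, Complex.norm_ofNat, mul_one] at h
  have h2 := norm_sub_norm_le (Complex.exp (-w * Complex.I)) (Complex.exp (w * Complex.I))
  rw [norm_exp_neg_mul_I_eq, norm_exp_mul_I_eq] at h2
  linarith

/-- For y = Im w, e^y - e^(-y) = e^(-y)(e^(2y) - 1) ≥ 2y e^(-y). -/
lemma norm_exp_mul_I_div_le {w u : ℂ} (hw : 0 < w.im)
    (hu : (Real.exp w.im - Real.exp (-w.im)) / 2 ≤ ‖u‖) :
    ‖Complex.exp (w * Complex.I) / u‖ ≤ 1 / w.im := by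
  have h1 : Real.exp w.im = Real.exp (-w.im) * Real.exp (2 * w.im) := by
    rw [← Real.exp_add]; ring_nf
  have h2 := Real.add_one_le_exp (2 * w.im)
  have h3 := Real.exp_pos (-w.im)
  have h4 : Real.exp (-w.im) * w.im ≤ (Real.exp w.im - Real.exp (-w.im)) / 2 := by
    rw [h1]; nlinarith
  have h5 : 0 < ‖u‖ := lt_of_lt_of_le (by positivity) (h4.trans hu)
  rw [norm_div, norm_exp_mul_I_eq, div_le_div_iff₀ h5 hw]
  linarith

lemma pi_mul_div_two_im (z : ℂ) : (Real.pi * z / 2 : ℂ).im = Real.pi / 2 * z.im := by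
  have : (Real.pi * z / 2 : ℂ) = ((Real.pi / 2 : ℝ) : ℂ) * z := by push_cast; ring
  rw [this, Complex.im_ofReal_mul]

lemma hasDerivAt_pi_mul_div_two (z : ℂ) :
    HasDerivAt (fun z : ℂ => Real.pi * z / 2) ((Real.pi / 2 : ℝ) : ℂ) z := by
  have h := ((hasDerivAt_id z).const_mul (Real.pi : ℂ)).div_const 2
  convert! h using 1
  push_cast; ring

lemma norm_half_pi_mul_exp_div_le {z u : ℂ} (hz : 0 < z.im)
    (hu : (Real.exp (Real.pi * z / 2 : ℂ).im - Real.exp (-(Real.pi * z / 2 : ℂ).im)) / 2 ≤ ‖u‖) :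
    ‖((Real.pi / 2 : ℝ) : ℂ) * (Complex.exp (Real.pi * z / 2 * Complex.I) / u)‖ ≤ 1 / z.im := by
  have him := pi_mul_div_two_im z
  have hp := Real.pi_pos
  rw [norm_mul, Complex.norm_real, Real.norm_eq_abs, abs_of_pos (by positivity)]
  have := norm_exp_mul_I_div_le (w := Real.pi * z / 2) (by rw [him]; positivity) hu
  rw [him] at this
  calc _ ≤ Real.pi / 2 * (1 / (Real.pi / 2 * z.im)) := by gcongr
    _ = 1 / z.im := by field_simp

/-- The logarithmic derivative of `cos (π z / 2)` is close to `-iπ/2` high in the upper half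
plane. -/
lemma hasDerivAt_cos_half_pi {z : ℂ} (hz : 0 < z.im) :
    ∃ δ : ℂ, ‖δ‖ ≤ 1 / z.im ∧ HasDerivAt (fun z : ℂ => Complex.cos (Real.pi * z / 2))
      (Complex.cos (Real.pi * z / 2) * (-(Complex.I * (Real.pi / 2 : ℝ)) + δ)) z := by
  have hp := Real.pi_pos
  set w : ℂ := Real.pi * z / 2 with hw
  have hc0 : Complex.cos w ≠ 0 := by
    intro h0
    have := norm_cos_ge w
    rw [h0, norm_zero, hw, pi_mul_div_two_im] at this
    have h2 : Real.exp (-(Real.pi / 2 * z.im)) < Real.exp (Real.pi / 2 * z.im) :=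
      Real.exp_lt_exp.2 (by nlinarith [mul_pos hp hz])
    linarith
  -- This is the identity -tan w + i = i e^(iw)/cos w, multiplied by π/2.
  refine ⟨Complex.I * (((Real.pi / 2 : ℝ) : ℂ) * (Complex.exp (w * Complex.I) / Complex.cos w)),
    ?_, ?_⟩
  · rw [norm_mul, Complex.norm_I, one_mul]
    exact norm_half_pi_mul_exp_div_le hz (norm_cos_ge w)
  · have h := (Complex.hasDerivAt_cos w).comp z (hasDerivAt_pi_mul_div_two z)
    refine h.congr_deriv ?_
    rw [Complex.exp_mul_I]
    field_simp
    linear_combination (-Complex.sin w) * Complex.I_sq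

lemma hasDerivAt_sin_half_pi {z : ℂ} (hz : 0 < z.im) :
    ∃ δ : ℂ, ‖δ‖ ≤ 1 / z.im ∧ HasDerivAt (fun z : ℂ => Complex.sin (Real.pi * z / 2))
      (Complex.sin (Real.pi * z / 2) * (-(Complex.I * (Real.pi / 2 : ℝ)) + δ)) z := by
  have hp := Real.pi_pos
  set w : ℂ := Real.pi * z / 2 with hw
  have hc0 : Complex.sin w ≠ 0 := by
    intro h0
    have := norm_sin_ge w
    rw [h0, norm_zero, hw, pi_mul_div_two_im] at this
    have h2 : Real.exp (-(Real.pi / 2 * z.im)) < Real.exp (Real.pi / 2 * z.im) :=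
      Real.exp_lt_exp.2 (by nlinarith [mul_pos hp hz])
    linarith
  refine ⟨((Real.pi / 2 : ℝ) : ℂ) * (Complex.exp (w * Complex.I) / Complex.sin w), ?_, ?_⟩
  · exact norm_half_pi_mul_exp_div_le hz (norm_sin_ge w)
  · have h := (Complex.hasDerivAt_sin w).comp z (hasDerivAt_pi_mul_div_two z)
    refine h.congr_deriv ?_
    rw [Complex.exp_mul_I]
    field_simp
    ring

end TrigBounds

/-! ### Size and logarithmic derivative of Γ -/

section GammaBounds

lemma norm_log_sub_le {z : ℂ} (hre : 0 < z.re) (hre' : z.re ≤ 3 / 4) (him : 2 ≤ z.im) :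
    ‖Complex.log z - (Real.log z.im + Complex.I * (Real.pi / 2 : ℝ))‖ ≤ 9 / 8 / z.im := by
  have him0 : 0 < z.im := by linarith
  -- Chosen so that z = i·(Im z)·(1 + u) with |u| ≤ 1/2; the error is then log(1 + u), at most
  -- (3/2)|u|.
  set u : ℂ := -Complex.I * ((z.re / z.im : ℝ) : ℂ) with hu
  have hun : ‖u‖ = z.re / z.im := by
    rw [hu, norm_mul, norm_neg, Complex.norm_I, one_mul, Complex.norm_real, Real.norm_eq_abs,
      abs_of_pos (by positivity)]
  have hu2 : ‖u‖ ≤ 1 / 2 := by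
    rw [hun, div_le_iff₀ him0]; linarith
  have h1re : 0 < (1 + u).re := by simp [hu]
  have h1 : 1 + u ≠ 0 := by intro h; rw [h] at h1re; simp at h1re
  have hzI : z = (z.im : ℂ) * (Complex.I * (1 + u)) := by
    have hne : (z.im : ℂ) ≠ 0 := by exact_mod_cast him0.ne'
    rw [hu]; push_cast
    field_simp
    conv_lhs => rw [← Complex.re_add_im z]
    linear_combination (z.re : ℂ) * Complex.I_sq
  have hlog : Complex.log z = Real.log z.im + (Complex.I * (Real.pi / 2 : ℝ) + Complex.log (1 + u)) := by
    have hlI : Complex.log Complex.I = Complex.I * (Real.pi / 2 : ℝ) := by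
      rw [Complex.log_I]; push_cast; ring
    conv_lhs => rw [hzI]
    rw [Complex.log_ofReal_mul him0 (mul_ne_zero Complex.I_ne_zero h1),
      (Complex.log_mul_eq_add_log_iff Complex.I_ne_zero h1).2, hlI]
    have a2 := abs_lt.1 (Complex.abs_arg_lt_pi_div_two_iff.2 (Or.inl h1re))
    rw [Complex.arg_I]
    constructor <;> linarith [a2.1, a2.2, Real.pi_pos]
  rw [hlog, ← add_assoc, add_sub_cancel_left]
  refine (Complex.norm_log_one_add_half_le_self hu2).trans ?_
  rw [hun, mul_div_assoc']
  gcongr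
  linarith

/-- The logarithmic derivative of `Γ` is close to `log (im z) + iπ/2`. -/
lemma hasDerivAt_Gamma_approx {z : ℂ} (hre : 1 / 2 ≤ z.re) (hre' : z.re ≤ 3 / 4)
    (him : 2 ≤ z.im) :
    ∃ δ : ℂ, ‖δ‖ ≤ 19 / z.im ∧ HasDerivAt Complex.Gamma
      (Complex.Gamma z * (Real.log z.im + Complex.I * (Real.pi / 2 : ℝ) + δ)) z := by
  have him0 : 0 < z.im := by linarith
  refine ⟨(Complex.log z - (Real.log z.im + Complex.I * (Real.pi / 2 : ℝ)))
    + (-(1 / (2 * z))) + deriv binetSum z, ?_, ?_⟩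
  · have h1 := norm_log_sub_le (by linarith) hre' him
    have h2 : ‖-(1 / (2 * z))‖ ≤ 1 / 2 / z.im := by
      rw [norm_neg, norm_div, norm_mul, norm_one, Complex.norm_ofNat, div_div]
      have : z.im ≤ ‖z‖ := (le_abs_self _).trans (Complex.abs_im_le_norm z)
      gcongr
    -- For Im z ≥ 2 one has Im z - 1/2 ≥ (3/4) Im z, and (64/5)(4/3) < 17.1.
    have h3 : ‖deriv binetSum z‖ ≤ 17.1 / z.im := by
      refine (norm_deriv_binetSum_le hre him).trans ?_
      rw [div_le_div_iff₀ (by linarith) him0]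
      linarith
    refine norm_add₃_le.trans ?_
    calc _ ≤ 9 / 8 / z.im + 1 / 2 / z.im + 17.1 / z.im := by linarith
      _ = (9 / 8 + 1 / 2 + 17.1) / z.im := by ring
      _ ≤ 19 / z.im := by gcongr; norm_num
  · refine (hasDerivAt_Gamma_of_im_gt (by linarith) (by linarith)).congr_deriv ?_
    ring

lemma exp_eight_fifths_le : Real.exp (8 / 5) ≤ 4.96 := by
  have h : Real.exp (8 / 5) ^ 5 = Real.exp 1 ^ 8 := by
    rw [← Real.exp_nat_mul, ← Real.exp_nat_mul]; norm_num
  refine le_of_pow_le_pow_left₀ (n := 5) (by norm_num) (by norm_num) ?_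
  rw [h]
  calc Real.exp 1 ^ 8 ≤ 2.7182818286 ^ 8 := by gcongr; exact Real.exp_one_lt_d9.le
    _ ≤ 4.96 ^ 5 := by norm_num

lemma exp_pi_le : Real.exp Real.pi ≤ 25 := by
  have h : Real.exp (16 / 5) ^ 5 = Real.exp 1 ^ 16 := by
    rw [← Real.exp_nat_mul, ← Real.exp_nat_mul]; norm_num
  refine (Real.exp_le_exp.2 (by linarith [Real.pi_lt_d2] : Real.pi ≤ 16 / 5)).trans ?_
  refine le_of_pow_le_pow_left₀ (n := 5) (by norm_num) (by norm_num) ?_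
  rw [h]
  calc Real.exp 1 ^ 16 ≤ 2.7182818286 ^ 16 := by gcongr; exact Real.exp_one_lt_d9.le
    _ ≤ 25 ^ 5 := by norm_num

/-- This is θ ≤ tan θ for θ = π/2 - arg z, where tan θ = Re z / Im z. -/
lemma half_pi_sub_arg_mul_le {z : ℂ} (hre : 0 < z.re) (him : 0 < z.im) :
    (Real.pi / 2 - Complex.arg z) * z.im ≤ z.re := by
  have h1 := abs_lt.1 (Complex.abs_arg_lt_pi_div_two_iff.2 (Or.inl hre))
  have h0 : 0 < Complex.arg z := by
    rcases lt_or_eq_of_le (Complex.arg_nonneg_iff.2 him.le) with h | h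
    · exact h
    · have := (Complex.arg_eq_zero_iff.1 h.symm).2
      linarith
  have ht := Real.le_tan (x := Real.pi / 2 - Complex.arg z) (by linarith) (by linarith)
  rw [Real.tan_pi_div_two_sub, Complex.tan_arg, inv_div, le_div_iff₀ him] at ht
  exact ht

/-- Replacing arg z by π/2 in Re `stirlingMain` costs at most Re z, which the term -Re z pays for
exactly. The constant 12.5 bounds √(2π) e^(8/5). -/
lemma norm_Gamma_le_of_two_le_im {z : ℂ} (hre : 1 / 2 ≤ z.re) (him : 2 ≤ z.im) :
    ‖Complex.Gamma z‖ ≤ 12.5 * ‖z‖ ^ (z.re - 1 / 2) * Real.exp (-(Real.pi / 2 * z.im)) := by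
  have hz0 : 0 < ‖z‖ := by
    have := (le_abs_self _).trans (Complex.abs_im_le_norm z); linarith
  have hmu : ‖binetSum z‖ ≤ 8 / 5 := by
    refine (norm_binetSum_le (by linarith) (by linarith)).trans ?_
    rw [div_le_iff₀ (by linarith)]; linarith
  have hmain : (stirlingMain z).re ≤ Real.log ‖z‖ * (z.re - 1 / 2) + -(Real.pi / 2 * z.im) := by
    have := half_pi_sub_arg_mul_le (by linarith : 0 < z.re) (by linarith : 0 < z.im)
    have e : (stirlingMain z).re
        = Real.log ‖z‖ * (z.re - 1 / 2) - z.im * Complex.arg z - z.re := by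
      simp [stirlingMain, Complex.mul_re, Complex.log_re, Complex.log_im]; ring
    rw [e]; nlinarith
  have hsq : √(2 * Real.pi) ≤ 2.51 := by
    rw [Real.sqrt_le_left (by norm_num)]; nlinarith [Real.pi_lt_d4]
  rw [Gamma_eq_exp_stirlingMain (by linarith) (by linarith), norm_mul, Complex.norm_real,
    Real.norm_eq_abs, abs_of_nonneg (Real.sqrt_nonneg _), Complex.norm_exp, Complex.add_re,
    Real.rpow_def_of_pos hz0]
  have hb : (binetSum z).re ≤ 8 / 5 := (Complex.re_le_norm _).trans hmu
  calc √(2 * Real.pi) * Real.exp ((stirlingMain z).re + (binetSum z).re)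
      ≤ 2.51 * Real.exp (Real.log ‖z‖ * (z.re - 1 / 2) + -(Real.pi / 2 * z.im) + 8 / 5) := by
        gcongr
    _ = (2.51 * Real.exp (8 / 5)) * Real.exp (Real.log ‖z‖ * (z.re - 1 / 2))
        * Real.exp (-(Real.pi / 2 * z.im)) := by rw [Real.exp_add, Real.exp_add]; ring
    _ ≤ 12.5 * Real.exp (Real.log ‖z‖ * (z.re - 1 / 2)) * Real.exp (-(Real.pi / 2 * z.im)) := by
        gcongr; linarith [exp_eight_fifths_le]

lemma norm_Gamma_le_Gamma_re {z : ℂ} (hre : 0 < z.re) : ‖Complex.Gamma z‖ ≤ Real.Gamma z.re := by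
  rw [Complex.Gamma_eq_integral hre, Real.Gamma_eq_integral hre, Complex.GammaIntegral]
  refine (MeasureTheory.norm_integral_le_integral_norm _).trans (le_of_eq ?_)
  refine MeasureTheory.setIntegral_congr_fun measurableSet_Ioi fun x hx => ?_
  rw [norm_mul, Complex.norm_cpow_eq_rpow_re_of_pos hx, Complex.norm_real, Real.norm_eq_abs,
    abs_of_pos (Real.exp_pos _)]
  simp

/-- By convexity Γ ≤ 1 on [1, 2], so cΓ(c) = Γ(c + 1) ≤ 1. -/
lemma Real_Gamma_le_two {c : ℝ} (h1 : 1 / 2 ≤ c) (h2 : c ≤ 1) : Real.Gamma c ≤ 2 := by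
  have h := Real.convexOn_Gamma.le_max_of_mem_Icc (x := 1) (y := 2) (z := c + 1)
    (by simp) (by simp) ⟨by linarith, by linarith⟩
  rw [Real.Gamma_one, Real.Gamma_two, max_self, Real.Gamma_add_one (by linarith)] at h
  nlinarith [Real.Gamma_pos_of_pos (by linarith : 0 < c)]

end GammaBounds

/-! ### The product of trigonometric and Gamma factors -/

section Product

/-- The product `cos(πz/2)^a sin(πz/2)^b Γ(z)^(a+b)` occurring in `functionalFactor`. -/
noncomputable def trigGammaProduct (a b : ℕ) (z : ℂ) : ℂ :=
  Complex.cos (Real.pi * z / 2) ^ a * Complex.sin (Real.pi * z / 2) ^ b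
    * Complex.Gamma z ^ (a + b)

lemma HasDerivAt.pow_of_log {f : ℂ → ℂ} {z d : ℂ} (hf : HasDerivAt f (f z * d) z) (a : ℕ) :
    HasDerivAt (fun z => f z ^ a) (f z ^ a * (a * d)) z := by
  refine (hf.fun_pow a).congr_deriv ?_
  rcases a with _ | a
  · simp
  · rw [Nat.add_sub_cancel, pow_succ]; ring

lemma HasDerivAt.mul_of_log {f g : ℂ → ℂ} {z d e : ℂ} (hf : HasDerivAt f (f z * d) z)
    (hg : HasDerivAt g (g z * e) z) :
    HasDerivAt (fun z => f z * g z) (f z * g z * (d + e)) z := by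
  refine (hf.fun_mul hg).congr_deriv ?_
  ring

/-- Each trigonometric factor contributes -iπ/2 to the logarithmic derivative and each Gamma factor
+iπ/2. There are a + b of both kinds, so these constants cancel and the real main term (a + b)
log(Im z) is left. The error constant is 1 + 19. -/
lemma hasDerivAt_trigGammaProduct (a b : ℕ) {z : ℂ} (hre : 1 / 2 ≤ z.re) (hre' : z.re ≤ 3 / 4)
    (him : 2 ≤ z.im) :
    ∃ e : ℂ, ‖e‖ ≤ 20 * (a + b : ℕ) / z.im ∧ HasDerivAt (trigGammaProduct a b)
      (trigGammaProduct a b z * ((a + b : ℕ) * (Real.log z.im : ℂ) + e)) z := by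
  have him0 : 0 < z.im := by linarith
  obtain ⟨δ₁, h1, d1⟩ := hasDerivAt_cos_half_pi him0
  obtain ⟨δ₂, h2, d2⟩ := hasDerivAt_sin_half_pi him0
  obtain ⟨δ₃, h3, d3⟩ := hasDerivAt_Gamma_approx hre hre' him
  refine ⟨a * δ₁ + b * δ₂ + (a + b : ℕ) * δ₃, ?_, ?_⟩
  · refine norm_add₃_le.trans ?_
    simp only [norm_mul, Complex.norm_natCast]
    calc (a : ℝ) * ‖δ₁‖ + b * ‖δ₂‖ + (a + b : ℕ) * ‖δ₃‖
        ≤ a * (1 / z.im) + b * (1 / z.im) + (a + b : ℕ) * (19 / z.im) := by gcongr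
      _ = 20 * (a + b : ℕ) / z.im := by push_cast; ring
  · refine (((d1.pow_of_log a).mul_of_log (d2.pow_of_log b)).mul_of_log
      (d3.pow_of_log (a + b))).congr_deriv ?_
    rw [trigGammaProduct]
    congr 1
    push_cast
    ring

/-- The a + b factors e^(π Im z/2) from cosines and sines cancel the e^(-π Im z/2) of the Gamma
factors. -/
lemma norm_trigGammaProduct_le (a b : ℕ) {z : ℂ} (hre : 1 / 2 ≤ z.re) (him : 2 ≤ z.im) :
    ‖trigGammaProduct a b z‖ ≤ (12.5 * ‖z‖ ^ (z.re - 1 / 2)) ^ (a + b) := by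
  have hp := Real.pi_pos
  have habs : |(Real.pi * z / 2 : ℂ).im| = Real.pi / 2 * z.im := by
    rw [pi_mul_div_two_im, abs_of_nonneg (by positivity)]
  have h1 := norm_cos_le_exp (Real.pi * z / 2)
  have h2 := norm_sin_le_exp (Real.pi * z / 2)
  rw [habs] at h1 h2
  have h3 := norm_Gamma_le_of_two_le_im hre him
  rw [trigGammaProduct, norm_mul, norm_mul, norm_pow, norm_pow, norm_pow]
  calc _ ≤ Real.exp (Real.pi / 2 * z.im) ^ a * Real.exp (Real.pi / 2 * z.im) ^ b
        * (12.5 * ‖z‖ ^ (z.re - 1 / 2) * Real.exp (-(Real.pi / 2 * z.im))) ^ (a + b) := by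
        gcongr
    _ = (12.5 * ‖z‖ ^ (z.re - 1 / 2)
        * (Real.exp (-(Real.pi / 2 * z.im)) * Real.exp (Real.pi / 2 * z.im))) ^ (a + b) := by
        rw [← pow_add, ← mul_pow]; ring_nf
    _ = _ := by rw [← Real.exp_add, neg_add_cancel, Real.exp_zero, mul_one]

lemma norm_trigGammaProduct_le_of_im_le (a b : ℕ) {z : ℂ} (hre : 1 / 2 ≤ z.re) (hre' : z.re ≤ 1)
    (him0 : 0 ≤ z.im) (him : z.im ≤ 2) :
    ‖trigGammaProduct a b z‖ ≤ 50 ^ (a + b) := by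
  have hp := Real.pi_pos
  have habs : Real.exp |(Real.pi * z / 2 : ℂ).im| ≤ 25 := by
    rw [pi_mul_div_two_im, abs_of_nonneg (by positivity)]
    refine (Real.exp_le_exp.2 ?_).trans exp_pi_le
    nlinarith
  have h1 := (norm_cos_le_exp (Real.pi * z / 2)).trans habs
  have h2 := (norm_sin_le_exp (Real.pi * z / 2)).trans habs
  have h3 := (norm_Gamma_le_Gamma_re (by linarith)).trans (Real_Gamma_le_two hre hre')
  rw [trigGammaProduct, norm_mul, norm_mul, norm_pow, norm_pow, norm_pow]
  calc _ ≤ (25 : ℝ) ^ a * 25 ^ b * 2 ^ (a + b) := by gcongr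
    _ = 50 ^ (a + b) := by rw [← pow_add, ← mul_pow]; norm_num

lemma differentiableAt_trigGammaProduct (a b : ℕ) {z : ℂ} (hre : 0 < z.re) :
    DifferentiableAt ℂ (trigGammaProduct a b) z := by
  have hG : DifferentiableAt ℂ Complex.Gamma z := by
    refine Complex.differentiableAt_Gamma z fun m h => ?_
    have := congrArg Complex.re h
    simp at this
    have hm : (0 : ℝ) ≤ m := Nat.cast_nonneg m
    linarith
  unfold trigGammaProduct
  fun_prop

end Product

/-! ### The oscillatory integral on Re z = c -/

lemma add_pow_le_five_mul_pow {n : ℕ} (hn : 2 ≤ n) :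
    8 * (50 : ℝ) ^ n + 219 * (12.5 ^ n * √n) ≤ 5 * 240 ^ n := by
  have h1 : √(n : ℝ) ≤ 2 ^ n := by
    have h : (n : ℝ) ≤ 2 ^ n := by exact_mod_cast n.lt_two_pow_self.le
    have h1n : (1 : ℝ) ≤ n := by exact_mod_cast (by omega : 1 ≤ n)
    refine le_trans (Real.sqrt_le_left (by linarith) |>.2 ?_) h
    nlinarith
  have h2 : (12.5 : ℝ) ^ n * √n ≤ 25 ^ n := by
    calc (12.5 : ℝ) ^ n * √n ≤ 12.5 ^ n * 2 ^ n := by gcongr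
      _ = 25 ^ n := by rw [← mul_pow]; norm_num
  obtain ⟨m, rfl⟩ := Nat.exists_eq_add_of_le hn
  have h3 : (50 : ℝ) ^ m ≤ 240 ^ m := by gcongr; norm_num
  have h4 : (25 : ℝ) ^ m ≤ 240 ^ m := by gcongr; norm_num
  rw [pow_add 25] at h2
  rw [pow_add 240, pow_add 50]
  have h5 : (0 : ℝ) < 240 ^ m := by positivity
  linarith

lemma hasDerivAt_vertical_line (c τ : ℝ) :
    HasDerivAt (fun τ : ℝ => (c : ℂ) + (τ : ℂ) * Complex.I) Complex.I τ := by
  have h := ((hasDerivAt_id τ).ofReal_comp.mul_const Complex.I).const_add (c : ℂ)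
  simpa using h

lemma norm_ofReal_cpow_neg {X : ℝ} (hX : 0 < X) (z : ℂ) : ‖(X : ℂ) ^ (-z)‖ = X ^ (-z.re) := by
  rw [Complex.norm_cpow_eq_rpow_re_of_pos hX, Complex.neg_re]

/-- The central oscillatory integral: on the line `re z = 1/2 + 1/(2n)` the integrand has size
`(im z)^(-1/2)`, and its integral is bounded uniformly in the height. -/
theorem norm_integral_trigGammaProduct_le {X : ℝ} (hX : 0 < X) {a b n : ℕ} (hab : a + b = n)
    (hn : 2 ≤ n) {c : ℝ} (hc : c = 1 / 2 + 1 / (2 * (n : ℝ))) {B l : ℂ → ℂ}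
    (hB : ∀ z : ℂ, z.re = c → HasDerivAt B (B z * l z) z)
    (hBn : ∀ z : ℂ, z.re = c → ‖B z‖ ≤ 1 / ‖1 - z‖)
    (hl : ∀ z : ℂ, z.re = c → 2 ≤ z.im → ‖l z‖ ≤ 3 * n / z.im) {T : ℝ} (hT : 0 ≤ T) :
    ‖∫ τ in (0 : ℝ)..T, (X : ℂ) ^ (-((c : ℂ) + (τ : ℂ) * Complex.I))
      * trigGammaProduct a b ((c : ℂ) + (τ : ℂ) * Complex.I)
      * B ((c : ℂ) + (τ : ℂ) * Complex.I)‖ ≤ X ^ (-c) * (5 * 240 ^ n) := by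
  have hnR : (2 : ℝ) ≤ n := by exact_mod_cast hn
  have hn0 : (0 : ℝ) < n := by linarith
  have hc1 : 1 / 2 ≤ c := by rw [hc]; have : 0 < 1 / (2 * (n : ℝ)) := by positivity
                             linarith
  have hc2 : c ≤ 3 / 4 := by
    have : 1 / (2 * (n : ℝ)) ≤ 1 / 4 := one_div_le_one_div_of_le (by norm_num) (by linarith)
    rw [hc]; linarith
  set G : ℂ → ℂ := fun z => (X : ℂ) ^ (-z) * trigGammaProduct a b z * B z with hG
  set L : ℝ → ℂ := fun τ => (c : ℂ) + (τ : ℂ) * Complex.I with hL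
  have hLre : ∀ τ, (L τ).re = c := fun τ => by simp [hL]
  have hLim : ∀ τ, (L τ).im = τ := fun τ => by simp [hL]
  have hXc : (X : ℂ) ≠ 0 := by exact_mod_cast hX.ne'
  have hLX : ∀ z : ℂ, HasDerivAt (fun z : ℂ => (X : ℂ) ^ (-z))
      ((X : ℂ) ^ (-z) * (-(Real.log X : ℂ))) z := by
    intro z
    have h := (hasDerivAt_neg z).const_cpow (Or.inl hXc)
    refine h.congr_deriv ?_
    rw [Complex.ofReal_log hX.le]; ring
  have hXP : 0 < X ^ (-c) := Real.rpow_pos_of_pos hX _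
  have hGd : ∀ τ, DifferentiableAt ℂ G (L τ) := fun τ =>
    ((hLX _).differentiableAt.mul (differentiableAt_trigGammaProduct a b
      (by rw [hLre]; linarith))).mul (hB _ (hLre τ)).differentiableAt
  set F : ℝ → ℂ := fun τ => G (L τ) with hF
  have hFc : Continuous F := by
    rw [continuous_iff_continuousAt]
    intro τ
    exact ContinuousAt.comp (hGd τ).continuousAt (hasDerivAt_vertical_line c τ).continuousAt
  have h1z : ∀ τ, 1 / 4 ≤ ‖1 - L τ‖ ∧ |τ| ≤ ‖1 - L τ‖ := by
    intro τ
    constructor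
    · have := Complex.abs_re_le_norm (1 - L τ)
      rw [Complex.sub_re, hLre, Complex.one_re] at this
      exact le_trans (by rw [abs_of_nonneg] <;> linarith) this
    · have := Complex.abs_im_le_norm (1 - L τ)
      rwa [Complex.sub_im, hLim, Complex.one_im, zero_sub, abs_neg] at this
  have hsmall : ∀ τ, 0 ≤ τ → τ ≤ 2 → ‖F τ‖ ≤ X ^ (-c) * (4 * 50 ^ n) := by
    intro τ h0 h2
    have hb : ‖B (L τ)‖ ≤ 4 := by
      refine (hBn _ (hLre τ)).trans ?_
      rw [div_le_iff₀ (by linarith [(h1z τ).1])]; linarith [(h1z τ).1]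
    have ht := norm_trigGammaProduct_le_of_im_le a b (z := L τ) (by rw [hLre]; linarith)
      (by rw [hLre]; linarith) (by rw [hLim]; exact h0) (by rw [hLim]; exact h2)
    rw [hab] at ht
    simp only [hF, hG]
    rw [norm_mul, norm_mul, norm_ofReal_cpow_neg hX, hLre]
    calc _ ≤ X ^ (-c) * 50 ^ n * 4 := by gcongr
      _ = _ := by ring
  have hsmallI : ∀ S, 0 ≤ S → S ≤ 2 → ‖∫ τ in (0 : ℝ)..S, F τ‖ ≤ X ^ (-c) * (8 * 50 ^ n) := by
    intro S h0 h2
    have := intervalIntegral.norm_integral_le_of_norm_le_const (a := 0) (b := S) (f := F)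
      (C := X ^ (-c) * (4 * 50 ^ n)) (by
        intro τ hτ
        rw [Set.uIoc_of_le h0] at hτ
        exact hsmall τ hτ.1.le (hτ.2.trans h2))
    refine this.trans ?_
    rw [sub_zero, abs_of_nonneg h0]
    calc _ ≤ X ^ (-c) * (4 * 50 ^ n) * 2 := by gcongr
      _ = _ := by ring
  have hfin := add_pow_le_five_mul_pow hn
  rcases le_total T 2 with hT2 | hT2
  · refine (hsmallI T hT hT2).trans ?_
    refine mul_le_mul_of_nonneg_left ?_ hXP.le
    have : 0 ≤ 219 * ((12.5 : ℝ) ^ n * √n) := by positivity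
    linarith
  have hex : ∀ τ : ℝ, ∃ e : ℂ, 2 ≤ τ → ‖e‖ ≤ 23 * n / τ ∧
      HasDerivAt F (F τ * (Complex.I * ((n * Real.log (τ / X ^ (1 / (n : ℝ))) : ℝ) : ℂ) + e)) τ := by
    intro τ
    by_cases hτ : 2 ≤ τ
    swap
    · exact ⟨0, fun h => absurd h hτ⟩
    have hτ0 : 0 < τ := by linarith
    obtain ⟨e, he, hd⟩ := hasDerivAt_trigGammaProduct a b (z := L τ) (by rw [hLre]; linarith)
      (by rw [hLre]; linarith) (by rw [hLim]; exact hτ)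
    rw [hLim, hab] at he hd
    refine ⟨Complex.I * (e + l (L τ)), fun _ => ⟨?_, ?_⟩⟩
    · rw [norm_mul, Complex.norm_I, one_mul]
      have hl' := hl _ (hLre τ) (by rw [hLim]; exact hτ)
      rw [hLim] at hl'
      calc _ ≤ 20 * n / τ + 3 * n / τ := (norm_add_le _ _).trans (add_le_add he hl')
        _ = 23 * n / τ := by ring
    · have h := (((hLX (L τ)).mul_of_log hd).mul_of_log (hB _ (hLre τ))).scomp τ
        (hasDerivAt_vertical_line c τ)
      refine h.congr_deriv ?_
      have hlog : n * Real.log (τ / X ^ (1 / (n : ℝ))) = n * Real.log τ - Real.log X := by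
        rw [Real.log_div hτ0.ne' (Real.rpow_pos_of_pos hX _).ne', Real.log_rpow hX]
        field_simp
      rw [hlog]
      simp only [hF, hG, smul_eq_mul]
      push_cast
      ring
  choose e he using hex
  -- The factor 1.2 comes from |L τ| ≤ c + τ ≤ 1.44 τ for τ ≥ 2.
  set A : ℝ := X ^ (-c) * (1.2 * 12.5 ^ n) with hA
  have hFA : ∀ τ, 2 ≤ τ → ‖F τ‖ ≤ A / √τ := by
    intro τ hτ
    have hτ0 : 0 < τ := by linarith
    have hs := Real.sqrt_pos.2 hτ0
    have ht := norm_trigGammaProduct_le a b (z := L τ) (by rw [hLre]; linarith)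
      (by rw [hLim]; exact hτ)
    rw [hab, hLre, mul_pow, ← Real.rpow_natCast (‖L τ‖ ^ (c - 1 / 2)), ← Real.rpow_mul
      (norm_nonneg _), show (c - 1 / 2) * (n : ℝ) = 1 / 2 by rw [hc]; field_simp; ring,
      ← Real.sqrt_eq_rpow] at ht
    have hLn : √‖L τ‖ ≤ 1.2 * √τ := by
      rw [show (1.2 : ℝ) = √(1.2 ^ 2) by rw [Real.sqrt_sq (by norm_num)],
        ← Real.sqrt_mul (by norm_num)]
      apply Real.sqrt_le_sqrt
      have : ‖L τ‖ ≤ c + τ := by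
        refine (norm_add_le _ _).trans (le_of_eq ?_)
        rw [norm_mul, Complex.norm_I, mul_one, Complex.norm_real, Complex.norm_real,
          Real.norm_eq_abs, Real.norm_eq_abs, abs_of_pos hτ0, abs_of_pos (by linarith)]
      nlinarith
    have hb : ‖B (L τ)‖ ≤ 1 / τ := by
      refine (hBn _ (hLre τ)).trans ?_
      have := (h1z τ).2
      rw [abs_of_pos hτ0] at this
      gcongr
    simp only [hF, hG]
    rw [norm_mul, norm_mul, norm_ofReal_cpow_neg hX, hLre]
    calc _ ≤ X ^ (-c) * (12.5 ^ n * (1.2 * √τ)) * (1 / τ) := by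
          gcongr; exact ht.trans (by gcongr)
      _ = A * (√τ / τ) := by rw [hA]; ring
      _ = A / √τ := by rw [Real.sqrt_div_self, div_eq_mul_inv]
  have hlarge := norm_integral_le_of_stationary_phase (F := F) (e := e) (N := n) (A := A) (E := 23)
    (t₀ := X ^ (1 / (n : ℝ))) (by linarith) (Real.rpow_pos_of_pos hX _) (by positivity)
    (by norm_num) hFc (fun t ht => (he t ht).2) hFA (fun t ht => (he t ht).1) hT2
  have hadd : ∫ τ in (0 : ℝ)..T, F τ = (∫ τ in (0 : ℝ)..2, F τ) + ∫ τ in (2 : ℝ)..T, F τ :=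
    (intervalIntegral.integral_add_adjacent_intervals (hFc.intervalIntegrable _ _)
      (hFc.intervalIntegrable _ _)).symm
  change ‖∫ τ in (0 : ℝ)..T, F τ‖ ≤ _
  rw [hadd]
  refine (norm_add_le _ _).trans ((add_le_add (hsmallI 2 (by norm_num) le_rfl) hlarge).trans ?_)
  have hpos : 0 ≤ (12.5 : ℝ) ^ n * √n := by positivity
  -- 1.2·(27 + 27·23/4) = 218.7.
  calc X ^ (-c) * (8 * 50 ^ n) + A * (27 + 27 / 4 * 23) * √n
      = X ^ (-c) * (8 * 50 ^ n + 218.7 * (12.5 ^ n * √n)) := by rw [hA]; ring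
    _ ≤ X ^ (-c) * (5 * 240 ^ n) := by
        refine mul_le_mul_of_nonneg_left ?_ hXP.le
        linarith

/-! ### The factor of the functional equation and its normal form -/

open NumberField.InfinitePlace in
lemma nrPlaces_add_eq_finrank (K : Type*) [Field K] [NumberField K] :
    (nrRealPlaces K + nrComplexPlaces K) + nrComplexPlaces K = Module.finrank ℚ K := by
  have := card_add_two_mul_card_eq_rank K
  omega

section FunctionalFactor

variable (K : Type*) [Field K] [NumberField K]

/-- The absolute value of the discriminant as a real number. -/
noncomputable def absDiscr : ℝ := |(NumberField.discr K : ℝ)|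

lemma absDiscr_pos : 0 < absDiscr K :=
  abs_pos.2 (by exact_mod_cast NumberField.discr_ne_zero K)

/-- The product of trigonometric and Gamma factors in `functionalFactor`. -/
noncomputable def archimedeanProduct (z : ℂ) : ℂ :=
  trigGammaProduct (NumberField.InfinitePlace.nrRealPlaces K
    + NumberField.InfinitePlace.nrComplexPlaces K) (NumberField.InfinitePlace.nrComplexPlaces K) z

lemma functionalFactor_eq (z : ℂ) :
    functionalFactor K z = ((2 : ℂ) ^ (1 - z) / (Real.pi : ℂ) ^ z) ^ Module.finrank ℚ K
      * (absDiscr K : ℂ) ^ (z - 1 / 2) * archimedeanProduct K z := by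
  rw [functionalFactor, archimedeanProduct, trigGammaProduct, nrPlaces_add_eq_finrank]
  have : (((|NumberField.discr K| : ℤ) : ℂ)) = (absDiscr K : ℂ) := by
    rw [absDiscr, ← Int.cast_abs]; norm_cast
  rw [this]
  ring

lemma archimedeanProduct_one : archimedeanProduct K 1 = 0 := by
  have h : 0 < NumberField.InfinitePlace.nrRealPlaces K
      + NumberField.InfinitePlace.nrComplexPlaces K := by
    have := nrPlaces_add_eq_finrank K
    have := Module.finrank_pos (R := ℚ) (M := K)
    omega
  rw [archimedeanProduct, trigGammaProduct, mul_one, Complex.cos_pi_div_two, zero_pow h.ne']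
  simp

lemma ofReal_cpow_eq_exp {y : ℝ} (hy : 0 < y) (w : ℂ) :
    (y : ℂ) ^ w = Complex.exp ((Real.log y : ℂ) * w) := by
  rw [Complex.cpow_def_of_ne_zero (by exact_mod_cast hy.ne'), Complex.ofReal_log hy.le]

/-- Under s ↦ 1 - s the sine and cosine of πs/2 change places, so the product is (S·C·Γ(s)Γ(1 -
s))^(a+b) with S = sin(πs/2) and C = cos(πs/2); the reflection formula and sin(πs) = 2SC then give
π/2 as the base. -/
lemma trigGammaProduct_mul_one_sub (a b : ℕ) {s : ℂ} (hs : Complex.sin (Real.pi * s) ≠ 0) :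
    trigGammaProduct a b s * trigGammaProduct a b (1 - s) = ((Real.pi : ℂ) / 2) ^ (a + b) := by
  have e : (Real.pi * (1 - s) / 2 : ℂ) = Real.pi / 2 - Real.pi * s / 2 := by ring
  have h2 : Complex.sin (Real.pi * s)
      = 2 * Complex.sin (Real.pi * s / 2) * Complex.cos (Real.pi * s / 2) := by
    rw [← Complex.sin_two_mul]; ring_nf
  have hG := Complex.Gamma_mul_Gamma_one_sub s
  rw [trigGammaProduct, trigGammaProduct, e, Complex.cos_pi_div_two_sub,
    Complex.sin_pi_div_two_sub]
  rw [h2] at hG hs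
  set S := Complex.sin (Real.pi * s / 2)
  set C := Complex.cos (Real.pi * s / 2)
  have hS : S ≠ 0 := by rintro h; simp [h] at hs
  have hC : C ≠ 0 := by rintro h; simp [h] at hs
  calc _ = ((S * C) * (Complex.Gamma s * Complex.Gamma (1 - s))) ^ (a + b) := by
        rw [mul_pow, mul_pow S, mul_pow (Complex.Gamma s), pow_add S, pow_add C]; ring
    _ = _ := by
        rw [hG]
        congr 1
        field_simp

lemma sin_pi_mul_ne_zero_of_re_mem {s : ℂ} (h1 : -1 < s.re) (h2 : s.re < 1) (h0 : s ≠ 0) :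
    Complex.sin (Real.pi * s) ≠ 0 := by
  intro h
  obtain ⟨k, hk⟩ := Complex.sin_eq_zero_iff.1 h
  have hp : (Real.pi : ℂ) ≠ 0 := by exact_mod_cast Real.pi_ne_zero
  have hs : s = k := by
    apply mul_left_cancel₀ hp
    rw [hk]; ring
  rw [hs] at h1 h2 h0
  simp only [Complex.intCast_re] at h1 h2
  have h3 : (-1 : ℤ) < k := by exact_mod_cast h1
  have h4 : k < 1 := by exact_mod_cast h2
  exact h0 (by rw [show k = 0 by omega]; simp)

/-- The functional equation of the factor `f`: `f(s) f(1 - s) = 1`. -/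
lemma inv_functionalFactor {s : ℂ} (h1 : -1 < s.re) (h2 : s.re < 1) :
    (functionalFactor K s)⁻¹ = functionalFactor K (1 - s) := by
  have hn : Module.finrank ℚ K ≠ 0 := (Module.finrank_pos (R := ℚ) (M := K)).ne'
  -- At s = 0 both sides vanish: the left through the conventions Γ(0) = 0 and 0⁻¹ = 0, the right
  -- because cos(π/2) = 0.
  rcases eq_or_ne s 0 with rfl | h0
  · rw [functionalFactor_eq K (1 - 0), sub_zero, archimedeanProduct_one, mul_zero,
      functionalFactor, Complex.Gamma_zero, zero_pow hn, mul_zero, inv_zero]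
  · apply inv_eq_of_mul_eq_one_right
    have hA : archimedeanProduct K s * archimedeanProduct K (1 - s)
        = ((Real.pi : ℂ) / 2) ^ Module.finrank ℚ K := by
      rw [archimedeanProduct, archimedeanProduct,
        trigGammaProduct_mul_one_sub _ _ (sin_pi_mul_ne_zero_of_re_mem h1 h2 h0), nrPlaces_add_eq_finrank]
    have hp : (Real.pi : ℂ) ≠ 0 := by exact_mod_cast Real.pi_ne_zero
    have hD : (absDiscr K : ℂ) ≠ 0 := by exact_mod_cast (absDiscr_pos K).ne'
    have e1 : (absDiscr K : ℂ) ^ (s - 1 / 2) * (absDiscr K : ℂ) ^ (1 - s - 1 / 2) = 1 := by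
      rw [← Complex.cpow_add _ _ hD]; ring_nf; simp
    have e2 : (2 : ℂ) ^ (1 - s) / (Real.pi : ℂ) ^ s * ((2 : ℂ) ^ (1 - (1 - s))
        / (Real.pi : ℂ) ^ (1 - s)) = 2 / Real.pi := by
      rw [div_mul_div_comm, ← Complex.cpow_add _ _ two_ne_zero, ← Complex.cpow_add _ _ hp,
        add_sub_cancel, add_sub_cancel, Complex.cpow_one, Complex.cpow_one]
    rw [functionalFactor_eq, functionalFactor_eq]
    calc _ = ((2 : ℂ) ^ (1 - s) / (Real.pi : ℂ) ^ s * ((2 : ℂ) ^ (1 - (1 - s))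
        / (Real.pi : ℂ) ^ (1 - s))) ^ Module.finrank ℚ K
        * ((absDiscr K : ℂ) ^ (s - 1 / 2) * (absDiscr K : ℂ) ^ (1 - s - 1 / 2))
        * (archimedeanProduct K s * archimedeanProduct K (1 - s)) := by
          rw [mul_pow]; ring
      _ = 1 := by
          rw [e1, e2, hA, mul_one, ← mul_pow]
          rw [show (2 : ℂ) / Real.pi * (Real.pi / 2) = 1 by field_simp, one_pow]

/-- The natural variable `x (2π)^n / |Δ|`. -/
noncomputable def scaledVar (x : ℝ) : ℝ :=
  x * (2 * Real.pi) ^ Module.finrank ℚ K / absDiscr K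

/-- The constant `x |Δ|^(-1/2) 2^n`. -/
noncomputable def scaleConst (x : ℝ) : ℝ :=
  x * absDiscr K ^ (-(1 / 2) : ℝ) * 2 ^ Module.finrank ℚ K

lemma scaledVar_pos {x : ℝ} (hx : 0 < x) : 0 < scaledVar K x := by
  have := absDiscr_pos K
  have := Real.pi_pos
  unfold scaledVar; positivity

lemma scaleConst_pos {x : ℝ} (hx : 0 < x) : 0 < scaleConst K x := by
  have := Real.rpow_pos_of_pos (absDiscr_pos K) (-(1 / 2) : ℝ)
  unfold scaleConst; positivity

lemma cpow_mul_functionalFactor {x : ℝ} (hx : 0 < x) (z : ℂ) :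
    (x : ℂ) ^ (1 - z) * functionalFactor K z
      = (scaleConst K x : ℂ) * ((scaledVar K x : ℂ) ^ (-z) * archimedeanProduct K z) := by
  have hD := absDiscr_pos K
  have hpi := Real.pi_pos
  have h2 : (2 : ℂ) ^ (1 - z) = Complex.exp ((Real.log 2 : ℂ) * (1 - z)) := by
    simpa using ofReal_cpow_eq_exp (y := 2) (by norm_num) (1 - z)
  have hX : Real.log (scaledVar K x) = Real.log x
      + Module.finrank ℚ K * (Real.log 2 + Real.log Real.pi) - Real.log (absDiscr K) := by
    rw [scaledVar, Real.log_div (by positivity) hD.ne', Real.log_mul hx.ne' (by positivity),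
      Real.log_pow, Real.log_mul (by norm_num) hpi.ne']
  have hC : scaleConst K x = Real.exp (Real.log x + -(1 / 2) * Real.log (absDiscr K)
      + Module.finrank ℚ K * Real.log 2) := by
    rw [Real.exp_add, Real.exp_add, Real.exp_log hx, scaleConst, Real.rpow_def_of_pos hD,
      Real.exp_nat_mul, Real.exp_log (by norm_num)]
    ring_nf
  rw [functionalFactor_eq, ofReal_cpow_eq_exp hx, h2, ofReal_cpow_eq_exp hpi,
    ofReal_cpow_eq_exp hD, ofReal_cpow_eq_exp (scaledVar_pos K hx), hX, hC, ← Complex.exp_sub,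
    ← Complex.exp_nat_mul, ← mul_assoc, ← mul_assoc, ← mul_assoc, Complex.ofReal_exp,
    ← Complex.exp_add, ← Complex.exp_add, ← Complex.exp_add]
  congr 2
  push_cast
  ring

/-- The kernel `x^(s+k) / (s (s+1) ⋯ (s+k)) · f(1 - s)`, whose `k`-th derivative in `x` is the
kernel for `k = 0`. -/
noncomputable def verticalKernel (k : ℕ) (x : ℝ) (s : ℂ) : ℂ :=
  (x : ℂ) ^ (s + k) / (∏ j ∈ Finset.range (k + 1), (s + (j : ℂ))) * functionalFactor K (1 - s)

lemma landauIntegrand_eq (x : ℝ) {s : ℂ} (h1 : -1 < s.re) (h2 : s.re < 1) :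
    landauIntegrand K x s = verticalKernel K (Module.finrank ℚ K) x s := by
  rw [landauIntegrand, inv_functionalFactor K h1 h2, verticalKernel]

lemma verticalKernel_eq (k : ℕ) {x : ℝ} (hx : 0 < x) (s : ℂ) :
    verticalKernel K k x s = ((scaleConst K x * x ^ k : ℝ) : ℂ)
      * ((scaledVar K x : ℂ) ^ (-(1 - s)) * archimedeanProduct K (1 - s))
      / ∏ j ∈ Finset.range (k + 1), (s + (j : ℂ)) := by
  have hxC : (x : ℂ) ≠ 0 := by exact_mod_cast hx.ne'
  have h := cpow_mul_functionalFactor K hx (1 - s)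
  rw [sub_sub_cancel] at h
  rw [verticalKernel, Complex.cpow_add _ _ hxC, Complex.cpow_natCast]
  push_cast
  linear_combination (x : ℂ) ^ k / (∏ j ∈ Finset.range (k + 1), (s + (j : ℂ))) * h

end FunctionalFactor

/-! ### Conjugation symmetry -/

section Symmetry

open ComplexConjugate

lemma trigGammaProduct_conj (a b : ℕ) (z : ℂ) :
    trigGammaProduct a b (conj z) = conj (trigGammaProduct a b z) := by
  have e : (Real.pi * conj z / 2 : ℂ) = conj (Real.pi * z / 2) := by
    rw [map_div₀, map_mul, Complex.conj_ofReal, map_ofNat]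
  rw [trigGammaProduct, trigGammaProduct, e, Complex.cos_conj, Complex.sin_conj,
    Complex.Gamma_conj]
  simp

lemma ofReal_cpow_conj {X : ℝ} (hX : 0 < X) (z : ℂ) :
    (X : ℂ) ^ (conj z) = conj ((X : ℂ) ^ z) := by
  rw [ofReal_cpow_eq_exp hX, ofReal_cpow_eq_exp hX, ← Complex.exp_conj]
  simp

/-- Lets the estimates, proved only in the upper half plane, control integrals over symmetric
segments. -/
lemma norm_symm_integral_le {F : ℝ → ℂ} (hF : Continuous F) (hs : ∀ t, F (-t) = conj (F t))
    (T : ℝ) : ‖∫ t in (-T)..T, F t‖ ≤ 2 * ‖∫ t in (0 : ℝ)..T, F t‖ := by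
  have h1 : ∫ t in (-T)..T, F t = (∫ t in (-T)..0, F t) + ∫ t in (0 : ℝ)..T, F t :=
    (intervalIntegral.integral_add_adjacent_intervals (hF.intervalIntegrable _ _)
      (hF.intervalIntegrable _ _)).symm
  have h2 : ∫ t in (-T)..0, F t = conj (∫ t in (0 : ℝ)..T, F t) := by
    have h3 := intervalIntegral.integral_comp_neg (a := 0) (b := T) F
    rw [neg_zero] at h3
    rw [← h3, ← intervalIntegral.intervalIntegral_conj]
    exact intervalIntegral.integral_congr fun t _ => hs t
  rw [h1]
  refine (norm_add_le _ _).trans ?_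
  rw [h2, RCLike.norm_conj]
  linarith

end Symmetry

/-! ### Symmetric integrals and the algebra of the shift z ↦ z + 1 -/

section CoreBounds

open ComplexConjugate

lemma norm_symm_integral_trigGammaProduct_le {X : ℝ} (hX : 0 < X) {a b n : ℕ} (hab : a + b = n)
    (hn : 2 ≤ n) {c : ℝ} (hc : c = 1 / 2 + 1 / (2 * (n : ℝ))) {B l : ℂ → ℂ}
    (hB : ∀ z : ℂ, z.re = c → HasDerivAt B (B z * l z) z)
    (hBn : ∀ z : ℂ, z.re = c → ‖B z‖ ≤ 1 / ‖1 - z‖)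
    (hl : ∀ z : ℂ, z.re = c → 2 ≤ z.im → ‖l z‖ ≤ 3 * n / z.im)
    (hBc : ∀ z, B (conj z) = conj (B z)) {T : ℝ} (hT : 0 ≤ T) :
    ‖∫ τ in (-T)..T, (X : ℂ) ^ (-((c : ℂ) + (τ : ℂ) * Complex.I))
      * trigGammaProduct a b ((c : ℂ) + (τ : ℂ) * Complex.I)
      * B ((c : ℂ) + (τ : ℂ) * Complex.I)‖ ≤ 2 * (X ^ (-c) * (5 * 240 ^ n)) := by
  have hn0 : (0 : ℝ) < n := by exact_mod_cast (by omega : 0 < n)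
  have hc0 : 0 < c := by rw [hc]; positivity
  have hXc : (X : ℂ) ≠ 0 := by exact_mod_cast hX.ne'
  refine (norm_symm_integral_le ?_ ?_ T).trans (mul_le_mul_of_nonneg_left
    (norm_integral_trigGammaProduct_le hX hab hn hc hB hBn hl hT) (by norm_num))
  · rw [continuous_iff_continuousAt]
    intro τ
    have hre : ((c : ℂ) + (τ : ℂ) * Complex.I).re = c := by simp
    have h1 : DifferentiableAt ℂ (fun z : ℂ => (X : ℂ) ^ (-z) * trigGammaProduct a b z * B z)
        ((c : ℂ) + (τ : ℂ) * Complex.I) :=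
      (((hasDerivAt_neg _).const_cpow (Or.inl hXc)).differentiableAt.mul
        (differentiableAt_trigGammaProduct a b (by rw [hre]; exact hc0))).mul
        (hB _ hre).differentiableAt
    exact ContinuousAt.comp (f := fun τ : ℝ => (c : ℂ) + (τ : ℂ) * Complex.I) h1.continuousAt
      (hasDerivAt_vertical_line c τ).continuousAt
  · intro τ
    have e : (c : ℂ) + ((-τ : ℝ) : ℂ) * Complex.I = conj ((c : ℂ) + (τ : ℂ) * Complex.I) := by
      simp
    rw [e, ← map_neg, ofReal_cpow_conj hX, trigGammaProduct_conj, hBc, map_mul, map_mul]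

/-- This carries the line Re z = 1 + c to Re z = c. The quarter period shift exchanges a and b, and
the recurrence of Γ produces z^(a+b). -/
lemma trigGammaProduct_add_one (a b : ℕ) {z : ℂ} (hz : z ≠ 0) :
    trigGammaProduct a b (z + 1) = (-1) ^ a * z ^ (a + b) * trigGammaProduct b a z := by
  have e : (Real.pi * (z + 1) / 2 : ℂ) = Real.pi * z / 2 + Real.pi / 2 := by ring
  rw [trigGammaProduct, trigGammaProduct, e, Complex.cos_add_pi_div_two,
    Complex.sin_add_pi_div_two, Complex.Gamma_add_one z hz, neg_pow, mul_pow, add_comm b a]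
  ring

lemma hasDerivAt_prod_inv_sub {m : ℕ} {z : ℂ} (hz : ∀ j : ℕ, (j : ℂ) - z ≠ 0) :
    HasDerivAt (fun z => ∏ j ∈ Finset.range m, ((j : ℂ) - z)⁻¹)
      ((∏ j ∈ Finset.range m, ((j : ℂ) - z)⁻¹) * ∑ j ∈ Finset.range m, ((j : ℂ) - z)⁻¹) z := by
  induction m with
  | zero => simpa using hasDerivAt_const z (1 : ℂ)
  | succ m ih =>
    simp only [Finset.prod_range_succ, Finset.sum_range_succ]
    refine ih.mul_of_log ?_
    refine (((hasDerivAt_id z).const_sub (m : ℂ)).fun_inv (hz m)).congr_deriv ?_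
    have := hz m
    simp only [id]
    field_simp

/-- The factor j = 0 has norm |z|, and for j ≥ 2 the point j is at least as far from z as 0 is,
because Re z ≤ 1. The factor j = 1 is kept: it provides the decay. -/
lemma norm_pow_mul_le_prod {z : ℂ} (h1 : z.re ≤ 1) {n : ℕ} (hn : 1 ≤ n) :
    ‖z‖ ^ n * ‖1 - z‖ ≤ ∏ j ∈ Finset.range (n + 1), ‖(j : ℂ) - z‖ := by
  induction n, hn using Nat.le_induction with
  | base => simp [Finset.prod_range_succ]
  | succ n hn ih =>
    rw [Finset.prod_range_succ]
    have h : ‖z‖ ≤ ‖((n + 1 : ℕ) : ℂ) - z‖ := by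
      rw [← sq_le_sq₀ (norm_nonneg _) (norm_nonneg _), Complex.sq_norm, Complex.sq_norm,
        Complex.normSq_apply, Complex.normSq_apply]
      have : (1 : ℝ) ≤ n := by exact_mod_cast hn
      simp
      nlinarith
    calc ‖z‖ ^ (n + 1) * ‖1 - z‖ = ‖z‖ ^ n * ‖1 - z‖ * ‖z‖ := by ring
      _ ≤ _ := by gcongr

end CoreBounds

/-! ### Uniform bounds on the lines Re s = 1 - c and Re s = -c -/

section VerticalLines

open ComplexConjugate

variable (K : Type*) [Field K] [NumberField K]

lemma natCast_sub_ne_zero {z : ℂ} (h0 : 0 < z.re) (h1 : z.re < 1) (j : ℕ) : (j : ℂ) - z ≠ 0 := by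
  intro h
  have h2 := congrArg Complex.re h
  simp only [Complex.sub_re, Complex.natCast_re, Complex.zero_re] at h2
  rcases j with _ | j
  · simp at h2; linarith
  · push_cast at h2
    have : (0 : ℝ) ≤ j := Nat.cast_nonneg j
    linarith

lemma norm_inv_natCast_sub_le {z : ℂ} (hz : 2 ≤ z.im) (j : ℕ) :
    ‖((j : ℂ) - z)⁻¹‖ ≤ 1 / z.im := by
  rw [norm_inv, ← one_div]
  have h := Complex.abs_im_le_norm ((j : ℂ) - z)
  rw [Complex.sub_im, Complex.natCast_im, zero_sub, abs_neg] at h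
  exact one_div_le_one_div_of_le (by linarith) ((le_abs_self _).trans h)

lemma integral_symm_comp_neg (F : ℝ → ℂ) (T : ℝ) :
    ∫ t in (-T)..T, F (-t) = ∫ t in (-T)..T, F t := by
  rw [intervalIntegral.integral_comp_neg, neg_neg]

/-- Bound for the integral of the `n`-times differentiated kernel on `re s = 1/2 - 1/(2n)`. -/
lemma norm_integral_verticalKernel_zero_le {n : ℕ} (hn : Module.finrank ℚ K = n) (hn2 : 2 ≤ n)
    {c : ℝ} (hc : c = 1 / 2 + 1 / (2 * (n : ℝ))) {x : ℝ} (hx : 0 < x) {T : ℝ} (hT : 0 ≤ T) :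
    ‖∫ t in (-T)..T, verticalKernel K 0 x (((1 - c : ℝ) : ℂ) + (t : ℂ) * Complex.I)‖
      ≤ scaleConst K x * (2 * (scaledVar K x ^ (-c) * (5 * 240 ^ n))) := by
  have hnR : (2 : ℝ) ≤ n := by exact_mod_cast hn2
  have hc0 : 0 < c := by rw [hc]; positivity
  have hc1 : c < 1 := by
    have : 1 / (2 * (n : ℝ)) ≤ 1 / 4 := one_div_le_one_div_of_le (by norm_num) (by linarith)
    rw [hc]; linarith
  have hab := nrPlaces_add_eq_finrank K
  rw [hn] at hab
  have hne : ∀ z : ℂ, z.re = c → 1 - z ≠ 0 := fun z hz => by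
    simpa using natCast_sub_ne_zero (z := z) (by rw [hz]; exact hc0) (by rw [hz]; exact hc1) 1
  have key := norm_symm_integral_trigGammaProduct_le (scaledVar_pos K hx) hab hn2 hc
    (B := fun z => (1 - z)⁻¹) (l := fun z => (1 - z)⁻¹)
    (fun z hz => by
      refine (((hasDerivAt_id z).const_sub 1).fun_inv (hne z hz)).congr_deriv ?_
      have := hne z hz
      simp only [id]
      field_simp)
    (fun z _ => by rw [norm_inv, one_div])
    (fun z _ him => by
      have h := norm_inv_natCast_sub_le him 1
      rw [Nat.cast_one] at h
      exact h.trans (div_le_div_of_nonneg_right (by linarith) (by linarith)))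
    (fun z => by rw [map_inv₀, map_sub, map_one]) hT
  -- The reflection t ↦ -t makes 1 - s equal to c + it.
  rw [← integral_symm_comp_neg]
  have e : ∀ t : ℝ, verticalKernel K 0 x (((1 - c : ℝ) : ℂ) + ((-t : ℝ) : ℂ) * Complex.I)
      = (scaleConst K x : ℂ) * ((scaledVar K x : ℂ) ^ (-((c : ℂ) + (t : ℂ) * Complex.I))
        * trigGammaProduct (NumberField.InfinitePlace.nrRealPlaces K
          + NumberField.InfinitePlace.nrComplexPlaces K)
          (NumberField.InfinitePlace.nrComplexPlaces K) ((c : ℂ) + (t : ℂ) * Complex.I)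
        * (1 - ((c : ℂ) + (t : ℂ) * Complex.I))⁻¹) := by
    intro t
    have e1 : 1 - (((1 - c : ℝ) : ℂ) + ((-t : ℝ) : ℂ) * Complex.I)
        = (c : ℂ) + (t : ℂ) * Complex.I := by push_cast; ring
    have e2 : ((1 - c : ℝ) : ℂ) + ((-t : ℝ) : ℂ) * Complex.I
        = 1 - ((c : ℂ) + (t : ℂ) * Complex.I) := by push_cast; ring
    rw [verticalKernel_eq K 0 hx, e1, archimedeanProduct, e2]
    simp [div_eq_mul_inv, mul_assoc]
  rw [intervalIntegral.integral_congr (fun t _ => e t), intervalIntegral.integral_const_mul,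
    norm_mul, Complex.norm_real, Real.norm_eq_abs, abs_of_pos (scaleConst_pos K hx)]
  exact mul_le_mul_of_nonneg_left key (scaleConst_pos K hx).le

/-- Bound for the integral of the kernel on `re s = -1/2 - 1/(2n)`. -/
lemma norm_integral_verticalKernel_finrank_le {n : ℕ} (hn : Module.finrank ℚ K = n) (hn2 : 2 ≤ n)
    {c : ℝ} (hc : c = 1 / 2 + 1 / (2 * (n : ℝ))) {x : ℝ} (hx : 0 < x) {T : ℝ} (hT : 0 ≤ T) :
    ‖∫ t in (-T)..T, verticalKernel K n x (((-c : ℝ) : ℂ) + (t : ℂ) * Complex.I)‖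
      ≤ scaleConst K x * x ^ n * (scaledVar K x)⁻¹
        * (2 * (scaledVar K x ^ (-c) * (5 * 240 ^ n))) := by
  have hnR : (2 : ℝ) ≤ n := by exact_mod_cast hn2
  have hc0 : 0 < c := by rw [hc]; positivity
  have hc1 : c < 1 := by
    have : 1 / (2 * (n : ℝ)) ≤ 1 / 4 := one_div_le_one_div_of_le (by norm_num) (by linarith)
    rw [hc]; linarith
  have hab := nrPlaces_add_eq_finrank K
  rw [hn] at hab
  have hX := scaledVar_pos K hx
  set a := NumberField.InfinitePlace.nrRealPlaces K
    + NumberField.InfinitePlace.nrComplexPlaces K with ha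
  set b := NumberField.InfinitePlace.nrComplexPlaces K with hb
  have hne : ∀ z : ℂ, z.re = c → ∀ j : ℕ, (j : ℂ) - z ≠ 0 := fun z hz =>
    natCast_sub_ne_zero (by rw [hz]; exact hc0) (by rw [hz]; exact hc1)
  have hz0 : ∀ z : ℂ, z.re = c → z ≠ 0 := by
    rintro z hz rfl
    simp at hz; linarith
  -- Here 1 - s = z + 1 with Re z = c. Hence the exponents a, b are exchanged, and B contains z^n
  -- together with all n + 1 denominators.
  have key := norm_symm_integral_trigGammaProduct_le hX (a := b) (b := a) (by omega) hn2 hc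
    (B := fun z => z ^ n * ∏ j ∈ Finset.range (n + 1), ((j : ℂ) - z)⁻¹)
    (l := fun z => n * z⁻¹ + ∑ j ∈ Finset.range (n + 1), ((j : ℂ) - z)⁻¹)
    (fun z hz => by
      have hz1 := hz0 z hz
      exact (HasDerivAt.pow_of_log ((hasDerivAt_id' z).congr_deriv (by field_simp)) n).mul_of_log
        (hasDerivAt_prod_inv_sub (hne z hz)))
    (fun z hz => by
      have h1 := norm_pow_mul_le_prod (z := z) (by rw [hz]; exact hc1.le) (by omega : 1 ≤ n)
      have h2 : 0 < ‖1 - z‖ := norm_pos_iff.2 (by simpa using hne z hz 1)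
      have h3 : 0 < ∏ j ∈ Finset.range (n + 1), ‖(j : ℂ) - z‖ :=
        Finset.prod_pos fun j _ => norm_pos_iff.2 (hne z hz j)
      rw [norm_mul, norm_pow, norm_prod]
      simp only [norm_inv]
      rw [Finset.prod_inv_distrib, ← div_eq_mul_inv, div_le_div_iff₀ h3 h2, one_mul]
      exact h1)
    (fun z hz him => by
      have h1 : ‖z⁻¹‖ ≤ 1 / z.im := by
        have h := norm_inv_natCast_sub_le him 0
        rwa [Nat.cast_zero, zero_sub, norm_inv, norm_neg, ← norm_inv] at h
      refine (norm_add_le _ _).trans ?_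
      rw [norm_mul, Complex.norm_natCast]
      calc (n : ℝ) * ‖z⁻¹‖ + ‖∑ j ∈ Finset.range (n + 1), ((j : ℂ) - z)⁻¹‖
          ≤ n * (1 / z.im) + ∑ j ∈ Finset.range (n + 1), 1 / z.im := by
            gcongr
            exact norm_sum_le_of_le _ fun j _ => norm_inv_natCast_sub_le him j
        _ = (2 * n + 1) / z.im := by
            rw [Finset.sum_const, Finset.card_range, nsmul_eq_mul]; push_cast; ring
        _ ≤ 3 * n / z.im := by gcongr; linarith)
    (fun z => by
      rw [map_mul, map_pow, map_prod]
      simp) hT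
  rw [← integral_symm_comp_neg]
  have e : ∀ t : ℝ, verticalKernel K n x (((-c : ℝ) : ℂ) + ((-t : ℝ) : ℂ) * Complex.I)
      = (((scaleConst K x * x ^ n * (scaledVar K x)⁻¹ : ℝ) : ℂ) * (-1) ^ a)
        * ((scaledVar K x : ℂ) ^ (-((c : ℂ) + (t : ℂ) * Complex.I))
        * trigGammaProduct b a ((c : ℂ) + (t : ℂ) * Complex.I)
        * (((c : ℂ) + (t : ℂ) * Complex.I) ^ n
          * ∏ j ∈ Finset.range (n + 1), ((j : ℂ) - ((c : ℂ) + (t : ℂ) * Complex.I))⁻¹)) := by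
    intro t
    set z : ℂ := (c : ℂ) + (t : ℂ) * Complex.I with hz
    have hzre : z.re = c := by simp [hz]
    have e1 : ((-c : ℝ) : ℂ) + ((-t : ℝ) : ℂ) * Complex.I = -z := by
      rw [hz]; push_cast; ring
    have hXC : (scaledVar K x : ℂ) ≠ 0 := by exact_mod_cast hX.ne'
    rw [e1, verticalKernel_eq K n hx, archimedeanProduct, sub_neg_eq_add, add_comm 1 z,
      trigGammaProduct_add_one _ _ (hz0 z hzre), ← ha, ← hb, hab, neg_add,
      Complex.cpow_add _ _ hXC, Complex.cpow_neg_one, Finset.prod_inv_distrib, div_eq_mul_inv]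
    have e3 : ∏ j ∈ Finset.range (n + 1), (-z + (j : ℂ))
        = ∏ j ∈ Finset.range (n + 1), ((j : ℂ) - z) :=
      Finset.prod_congr rfl fun j _ => by ring
    rw [e3]
    push_cast
    ring
  have hpos : 0 < scaleConst K x * x ^ n * (scaledVar K x)⁻¹ := by
    have := scaleConst_pos K hx
    positivity
  rw [intervalIntegral.integral_congr (fun t _ => e t), intervalIntegral.integral_const_mul,
    norm_mul, norm_mul, norm_pow, norm_neg, norm_one, one_pow, mul_one, Complex.norm_real,
    Real.norm_eq_abs, abs_of_pos hpos]
  exact mul_le_mul_of_nonneg_left key hpos.le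

end VerticalLines

/-! ### Moving the line of integration -/

section ContourShift

open ComplexConjugate

variable (K : Type*) [Field K] [NumberField K]

lemma verticalKernel_conj (k : ℕ) {x : ℝ} (hx : 0 < x) (s : ℂ) :
    verticalKernel K k x (conj s) = conj (verticalKernel K k x s) := by
  have e1 : 1 - conj s = conj (1 - s) := by simp
  rw [verticalKernel_eq K k hx, verticalKernel_eq K k hx, e1, ← map_neg,
    ofReal_cpow_conj (scaledVar_pos K hx), archimedeanProduct, trigGammaProduct_conj,
    ← archimedeanProduct]
  simp [map_prod]

lemma pow_le_norm_prod_add_natCast (m : ℕ) (s : ℂ) :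
    |s.im| ^ m ≤ ‖∏ j ∈ Finset.range m, (s + (j : ℂ))‖ := by
  rw [norm_prod, ← Finset.card_range m, ← Finset.prod_const, Finset.card_range]
  refine Finset.prod_le_prod (fun _ _ => abs_nonneg _) fun j _ => ?_
  simpa using Complex.abs_im_le_norm (s + (j : ℂ))

/-- Decay of the kernel in vertical strips. -/
lemma exists_norm_verticalKernel_le {n : ℕ} (hn : Module.finrank ℚ K = n) {x : ℝ} (hx : 0 < x) :
    ∃ C : ℝ, 0 ≤ C ∧ ∀ s : ℂ, -(3 / 4) ≤ s.re → s.re ≤ 1 / 2 → 2 ≤ |s.im| →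
      ‖verticalKernel K n x s‖ ≤ C * |s.im| ^ ((1 / 2 - s.re) * n - (n + 1)) := by
  have hab := nrPlaces_add_eq_finrank K
  rw [hn] at hab
  have hX := scaledVar_pos K hx
  have hκ : 0 < scaleConst K x * x ^ n := mul_pos (scaleConst_pos K hx) (by positivity)
  refine ⟨scaleConst K x * x ^ n * ((1 + (scaledVar K x)⁻¹ ^ 2) * 50 ^ n), by positivity, ?_⟩
  -- For Im s negative, 1 - s lies in the upper half plane, where the product bound applies; the
  -- other case follows by conjugation.
  have main : ∀ s : ℂ, -(3 / 4) ≤ s.re → s.re ≤ 1 / 2 → s.im ≤ -2 →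
      ‖verticalKernel K n x s‖ ≤ scaleConst K x * x ^ n * ((1 + (scaledVar K x)⁻¹ ^ 2) * 50 ^ n)
        * |s.im| ^ ((1 / 2 - s.re) * n - (n + 1)) := by
    intro s h1 h2 h3
    have hy : |s.im| = -s.im := abs_of_neg (by linarith)
    have hy2 : 2 ≤ |s.im| := by rw [hy]; linarith
    have hy0 : 0 < |s.im| := by linarith
    have hre : (1 - s).re = 1 - s.re := by simp
    have him : (1 - s).im = |s.im| := by rw [hy]; simp
    have hP := norm_trigGammaProduct_le (NumberField.InfinitePlace.nrRealPlaces K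
      + NumberField.InfinitePlace.nrComplexPlaces K) (NumberField.InfinitePlace.nrComplexPlaces K)
      (z := 1 - s) (by rw [hre]; linarith) (by rw [him]; exact hy2)
    rw [hab, hre, ← archimedeanProduct] at hP
    have hnorm : ‖1 - s‖ ≤ 2 * |s.im| := by
      have := Complex.norm_le_abs_re_add_abs_im (1 - s)
      rw [hre, him, abs_abs, abs_of_nonneg (by linarith : 0 ≤ 1 - s.re)] at this
      linarith
    have hP2 : ‖archimedeanProduct K (1 - s)‖ ≤ 50 ^ n * |s.im| ^ ((1 / 2 - s.re) * n) := by
      refine hP.trans ?_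
      rw [Real.rpow_mul hy0.le, Real.rpow_natCast, ← mul_pow]
      have e1 : (1 - s.re - 1 / 2 : ℝ) = 1 / 2 - s.re := by ring
      rw [e1]
      have h4 : (2 : ℝ) ^ (1 / 2 - s.re) ≤ 4 := by
        calc (2 : ℝ) ^ (1 / 2 - s.re) ≤ 2 ^ (2 : ℝ) :=
              Real.rpow_le_rpow_of_exponent_le (by norm_num) (by linarith)
          _ = 4 := by norm_num
      have h5 : ‖1 - s‖ ^ (1 / 2 - s.re) ≤ 4 * |s.im| ^ (1 / 2 - s.re) := by
        calc ‖1 - s‖ ^ (1 / 2 - s.re) ≤ (2 * |s.im|) ^ (1 / 2 - s.re) :=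
              Real.rpow_le_rpow (norm_nonneg _) hnorm (by linarith)
          _ = 2 ^ (1 / 2 - s.re) * |s.im| ^ (1 / 2 - s.re) :=
              Real.mul_rpow (by norm_num) hy0.le
          _ ≤ _ := by gcongr
      have h6 : 12.5 * ‖1 - s‖ ^ (1 / 2 - s.re) ≤ 50 * |s.im| ^ (1 / 2 - s.re) := by
        linarith
      gcongr
    have hXn : ‖(scaledVar K x : ℂ) ^ (-(1 - s))‖ ≤ 1 + (scaledVar K x)⁻¹ ^ 2 := by
      rw [norm_ofReal_cpow_neg hX, hre]
      rcases le_total 1 (scaledVar K x) with h | h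
      · have := Real.rpow_le_one_of_one_le_of_nonpos h (by linarith : -(1 - s.re) ≤ 0)
        have : 0 ≤ (scaledVar K x)⁻¹ ^ 2 := by positivity
        linarith
      · have := Real.rpow_le_rpow_of_exponent_ge hX h (by linarith : (-2 : ℝ) ≤ -(1 - s.re))
        have e : scaledVar K x ^ (-2 : ℝ) = (scaledVar K x)⁻¹ ^ 2 := by
          rw [Real.rpow_neg hX.le, Real.rpow_two, inv_pow]
        rw [e] at this
        linarith
    have hprod := pow_le_norm_prod_add_natCast (n + 1) s
    rw [verticalKernel_eq K n hx, norm_div, norm_mul, norm_mul, Complex.norm_real,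
      Real.norm_eq_abs, abs_of_pos hκ]
    calc _ ≤ scaleConst K x * x ^ n * ((1 + (scaledVar K x)⁻¹ ^ 2)
          * (50 ^ n * |s.im| ^ ((1 / 2 - s.re) * n))) / |s.im| ^ (n + 1) := by gcongr
      _ = _ := by
          rw [Real.rpow_sub hy0]
          have : |s.im| ^ ((n : ℝ) + 1) = |s.im| ^ (n + 1) := by
            rw [← Real.rpow_natCast]; push_cast; rfl
          rw [this]; ring
  intro s h1 h2 h3
  rcases le_abs.1 h3 with h | h
  · have := main (conj s) (by simpa using h1) (by simpa using h2) (by simp; linarith)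
    rw [verticalKernel_conj K n hx, RCLike.norm_conj] at this
    simpa using this
  · exact main s h1 h2 (by linarith)

/-- The kernel continued across its removable singularity at `s = 0`. -/
noncomputable def continuedKernel (n : ℕ) (x : ℝ) (s : ℂ) : ℂ :=
  ((scaleConst K x * x ^ n : ℝ) : ℂ) * ((scaledVar K x : ℂ) ^ (-(1 - s))
    * dslope (fun s => archimedeanProduct K (1 - s)) 0 s)
    / ∏ j ∈ Finset.range n, (s + ((j + 1 : ℕ) : ℂ))

lemma verticalKernel_eq_continuedKernel (n : ℕ) {x : ℝ} (hx : 0 < x) {s : ℂ} (hs : s ≠ 0) :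
    verticalKernel K n x s = continuedKernel K n x s := by
  rw [verticalKernel_eq K n hx, continuedKernel, dslope_of_ne _ hs, slope_def_field,
    sub_zero, sub_zero, archimedeanProduct_one, sub_zero, Finset.prod_range_succ', Nat.cast_zero,
    add_zero]
  field_simp

lemma differentiableOn_continuedKernel (n : ℕ) {x : ℝ} (hx : 0 < x) :
    DifferentiableOn ℂ (continuedKernel K n x) {s : ℂ | -1 < s.re ∧ s.re < 1} := by
  have hopen : IsOpen {s : ℂ | -1 < s.re ∧ s.re < 1} :=
    (isOpen_lt continuous_const Complex.continuous_re).inter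
      (isOpen_lt Complex.continuous_re continuous_const)
  have hX : (scaledVar K x : ℂ) ≠ 0 := by exact_mod_cast (scaledVar_pos K hx).ne'
  have h1 : DifferentiableOn ℂ (fun s => archimedeanProduct K (1 - s))
      {s : ℂ | -1 < s.re ∧ s.re < 1} := by
    intro s hs
    have : DifferentiableAt ℂ (archimedeanProduct K) (1 - s) :=
      differentiableAt_trigGammaProduct _ _ (by simpa using hs.2)
    exact (this.comp s (by fun_prop)).differentiableWithinAt
  have h2 := (Complex.differentiableOn_dslope (hopen.mem_nhds (show (0 : ℂ) ∈ _ by simp))).2 h1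
  unfold continuedKernel
  refine DifferentiableOn.div (DifferentiableOn.mul (by fun_prop) (DifferentiableOn.mul ?_ h2))
    (by fun_prop) ?_
  · intro s _
    exact (DifferentiableAt.const_cpow (by fun_prop) (Or.inl hX)).differentiableWithinAt
  · intro s hs
    rw [Finset.prod_ne_zero_iff]
    intro j _ h
    have := congrArg Complex.re h
    have hj : (0 : ℝ) ≤ j := Nat.cast_nonneg j
    push_cast at this
    simp at this
    linarith [hs.1]

lemma continuous_continuedKernel_line (n : ℕ) {x : ℝ} (hx : 0 < x) {σ : ℝ} (h1 : -1 < σ)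
    (h2 : σ < 1) : Continuous fun t : ℝ => continuedKernel K n x ((σ : ℂ) + (t : ℂ) * Complex.I) :=
  (differentiableOn_continuedKernel K n hx).continuousOn.comp_continuous (by fun_prop)
    (fun t => by simp [h1, h2])

/-- The integrals of the kernel over vertical lines to the right of `re s = -1/2 - 1/(2n)` all
converge to the same limit. -/
lemma exists_tendsto_integral_verticalKernel {n : ℕ} (hn : Module.finrank ℚ K = n) (hn2 : 2 ≤ n)
    {c : ℝ} (hc : c = 1 / 2 + 1 / (2 * (n : ℝ))) {x : ℝ} (hx : 0 < x) :
    ∃ L : ℂ, ∀ σ : ℝ, -c ≤ σ → σ ≤ 1 - c → σ ≠ 0 →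
      Tendsto (fun T : ℝ => ∫ t in (-T)..T, verticalKernel K n x ((σ : ℂ) + (t : ℂ) * Complex.I))
        atTop (𝓝 L) := by
  have hnR : (2 : ℝ) ≤ n := by exact_mod_cast hn2
  have hn0 : (0 : ℝ) < n := by linarith
  have hc1 : 1 / 2 ≤ c := by rw [hc]; have : 0 < 1 / (2 * (n : ℝ)) := by positivity
                             linarith
  have hc2 : c ≤ 3 / 4 := by
    have : 1 / (2 * (n : ℝ)) ≤ 1 / 4 := one_div_le_one_div_of_le (by norm_num) (by linarith)
    rw [hc]; linarith
  obtain ⟨C, hC0, hC⟩ := exists_norm_verticalKernel_le K hn hx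
  set H := continuedKernel K n x with hH
  have hline : ∀ σ : ℝ, σ ≠ 0 → ∀ t : ℝ,
      verticalKernel K n x ((σ : ℂ) + (t : ℂ) * Complex.I) = H ((σ : ℂ) + (t : ℂ) * Complex.I) := by
    intro σ hσ t
    refine verticalKernel_eq_continuedKernel K n hx fun h => hσ ?_
    simpa using congrArg Complex.re h
  have hbound : ∀ s : ℂ, -(3 / 4) ≤ s.re → s.re ≤ 1 / 2 → 2 ≤ |s.im| →
      ‖H s‖ ≤ C * |s.im| ^ ((1 / 2 - s.re) * n - (n + 1)) := by
    intro s h1 h2 h3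
    rw [hH, ← verticalKernel_eq_continuedKernel K n hx]
    · exact hC s h1 h2 h3
    · rintro rfl
      norm_num at h3
  -- absolute convergence on the line `re s = -1/4`
  obtain ⟨σ₀, hσ₀⟩ : ∃ σ₀ : ℝ, σ₀ = -(1 / 4) := ⟨_, rfl⟩
  have hcont := continuous_continuedKernel_line K n hx (σ := σ₀) (by rw [hσ₀]; norm_num)
    (by rw [hσ₀]; norm_num)
  have hint : MeasureTheory.Integrable fun t : ℝ => H ((σ₀ : ℂ) + (t : ℂ) * Complex.I) := by
    refine hcont.locallyIntegrable.integrable_of_isBigO_atTop_of_norm_isNegInvariant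
      (g := fun t : ℝ => t ^ (-(3 / 2) : ℝ)) ?_ ?_ ?_
    · refine Eventually.of_forall fun t => ?_
      change ‖H _‖ = ‖H _‖
      rw [← hline σ₀ (by rw [hσ₀]; norm_num), ← hline σ₀ (by rw [hσ₀]; norm_num),
        ← RCLike.norm_conj, ← verticalKernel_conj K n hx]
      congr 2
      simp
    · refine Asymptotics.IsBigO.of_bound C ?_
      filter_upwards [eventually_ge_atTop 2] with t ht
      have ht0 : 0 < t := by linarith
      have h := hbound ((σ₀ : ℂ) + (t : ℂ) * Complex.I) (by simp [hσ₀]; norm_num)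
        (by simp [hσ₀]; norm_num) (by simp [abs_of_pos ht0, ht])
      refine h.trans (mul_le_mul_of_nonneg_left ?_ hC0)
      have e1 : ((σ₀ : ℂ) + (t : ℂ) * Complex.I).im = t := by simp
      have e2 : ((σ₀ : ℂ) + (t : ℂ) * Complex.I).re = σ₀ := by simp
      rw [e1, e2, abs_of_pos ht0, Real.norm_eq_abs, abs_of_pos (Real.rpow_pos_of_pos ht0 _)]
      -- On Re s = -1/4 the decay exponent is -n/4 - 1, which is at most -3/2 because n ≥ 2.
      refine Real.rpow_le_rpow_of_exponent_le (by linarith) ?_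
      rw [hσ₀]; linarith
    · rw [integrableAtFilter_rpow_atTop_iff]; norm_num
  set L : ℂ := ∫ t : ℝ, H ((σ₀ : ℂ) + (t : ℂ) * Complex.I) with hL
  have hlim : Tendsto (fun T : ℝ => ∫ t in (-T)..T, H ((σ₀ : ℂ) + (t : ℂ) * Complex.I)) atTop
      (𝓝 L) :=
    MeasureTheory.intervalIntegral_tendsto_integral hint tendsto_neg_atTop_atBot tendsto_id
  refine ⟨L, fun σ h1 h2 h0 => ?_⟩
  have hdiff : Tendsto (fun T : ℝ => (∫ t in (-T)..T, H ((σ : ℂ) + (t : ℂ) * Complex.I))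
      - ∫ t in (-T)..T, H ((σ₀ : ℂ) + (t : ℂ) * Complex.I)) atTop (𝓝 0) := by
    have hz : Tendsto (fun T : ℝ => 2 * (C * T ^ (-(1 / 2) : ℝ) * |σ - σ₀|)) atTop (𝓝 0) := by
      have := ((tendsto_rpow_neg_atTop (by norm_num : (0 : ℝ) < 1 / 2)).const_mul C
        |>.mul_const |σ - σ₀|).const_mul 2
      simpa using this
    refine squeeze_zero_norm' ?_ hz
    filter_upwards [eventually_ge_atTop 2] with T hT
    have hT0 : 0 < T := by linarith
    have hrect := Complex.integral_boundary_rect_eq_zero_of_differentiableOn H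
      ((σ₀ : ℂ) + ((-T : ℝ) : ℂ) * Complex.I) ((σ : ℂ) + (T : ℂ) * Complex.I) (by
        refine (differentiableOn_continuedKernel K n hx).mono fun s hs => ?_
        have hs1 := hs.1
        simp only [Set.mem_preimage, Complex.add_re, Complex.ofReal_re, Complex.mul_re,
          Complex.I_re, mul_zero, Complex.ofReal_im, Complex.I_im, mul_one, sub_zero,
          add_zero] at hs1
        rcases Set.mem_uIcc.1 hs1 with h | h <;> constructor <;> linarith [h.1, h.2])
    simp only [Complex.add_re, Complex.ofReal_re, Complex.mul_re, Complex.I_re, mul_zero,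
      Complex.ofReal_im, Complex.I_im, mul_one, sub_zero, add_zero, Complex.add_im,
      Complex.mul_im, zero_add, smul_eq_mul] at hrect
    have hhor : ∀ y : ℝ, |y| = T →
        ‖∫ u in σ₀..σ, H ((u : ℂ) + (y : ℂ) * Complex.I)‖ ≤ C * T ^ (-(1 / 2) : ℝ) * |σ - σ₀| := by
      intro y hy
      refine intervalIntegral.norm_integral_le_of_norm_le_const fun u hu => ?_
      have hu' : -c ≤ u ∧ u ≤ 1 / 2 := by
        rcases Set.mem_uIoc.1 hu with h | h <;> constructor <;> linarith [h.1, h.2]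
      have e1 : ((u : ℂ) + (y : ℂ) * Complex.I).im = y := by simp
      have e2 : ((u : ℂ) + (y : ℂ) * Complex.I).re = u := by simp
      have h := hbound ((u : ℂ) + (y : ℂ) * Complex.I) (by rw [e2]; linarith [hu'.1])
        (by rw [e2]; exact hu'.2) (by rw [e1, hy]; exact hT)
      rw [e1, e2, hy] at h
      refine h.trans (mul_le_mul_of_nonneg_left ?_ hC0)
      refine Real.rpow_le_rpow_of_exponent_le (by linarith) ?_
      have h3 : (1 / 2 - u) * n ≤ (1 / 2 + c) * n := by
        gcongr; linarith [hu'.1]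
      -- The worst abscissa is u = -c; there the exponent is n + 1/2 - (n + 1) = -1/2, so the
      -- horizontal edges still tend to 0.
      have h4 : (1 / 2 + c) * n = n + 1 / 2 := by rw [hc]; field_simp; ring
      linarith
    have a1 := hhor (-T) (by rw [abs_neg, abs_of_pos hT0])
    have a2 := hhor T (abs_of_pos hT0)
    have e : Complex.I * ((∫ t in (-T)..T, H ((σ : ℂ) + (t : ℂ) * Complex.I))
        - ∫ t in (-T)..T, H ((σ₀ : ℂ) + (t : ℂ) * Complex.I))
        = (∫ u in σ₀..σ, H ((u : ℂ) + (T : ℂ) * Complex.I))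
          - ∫ u in σ₀..σ, H ((u : ℂ) + ((-T : ℝ) : ℂ) * Complex.I) := by
      linear_combination hrect
    have e' := congrArg norm e
    rw [norm_mul, Complex.norm_I, one_mul] at e'
    rw [e']
    refine (norm_sub_le _ _).trans ?_
    linarith
  have := hdiff.add hlim
  simp only [sub_add_cancel, zero_add] at this
  refine this.congr fun T => ?_
  exact intervalIntegral.integral_congr fun t _ => (hline σ h0 t).symm

end ContourShift

/-! ### Finite differences and differentiation in x -/

section Differences

lemma nthDifference_eq_fwdDiff_iter (n : ℕ) (v : ℝ) (g : ℝ → ℂ) (w : ℝ) :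
    nthDifference n v g w = (fwdDiff v)^[n] g w := by
  rw [fwdDiff_iter_eq_sum_shift, nthDifference]
  refine Finset.sum_congr rfl fun l _ => ?_
  rw [zsmul_eq_mul, nsmul_eq_mul]
  push_cast
  ring

/-- The `k`-th difference of a function whose `k`-th derivative is bounded by `M`; here `G j` is
the derivative of `G (j + 1)`. -/
lemma norm_fwdDiff_iter_le {v w : ℝ} (hv : 0 ≤ v) (k : ℕ) (G : ℕ → ℝ → ℂ) (M : ℝ)
    (hG : ∀ j, ∀ x, w ≤ x → HasDerivAt (G (j + 1)) (G j x) x)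
    (hM : ∀ x, w ≤ x → x ≤ w + k * v → ‖G 0 x‖ ≤ M) :
    ‖(fwdDiff v)^[k] (G k) w‖ ≤ v ^ k * M := by
  induction k generalizing G M with
  | zero => simpa using hM w le_rfl (by simp)
  | succ k ih =>
    rw [Function.iterate_succ_apply]
    -- One difference of G (j + 1) gives a new chain of successive derivatives; the mean value
    -- inequality bounds its lowest member by M·v.
    have h := ih (fun j x => G (j + 1) (x + v) - G (j + 1) x) (M * v)
      (fun j x hx => ((hG (j + 1) (x + v) (by linarith)).comp_add_const x v).sub
        (hG (j + 1) x hx))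
      (fun x hx hx' => by
        have h1 := (convex_Icc x (x + v)).norm_image_sub_le_of_norm_hasDerivWithin_le
          (f := G 1) (f' := G 0) (C := M) (x := x) (y := x + v)
          (fun y hy => (hG 0 y (by linarith [hy.1])).hasDerivWithinAt)
          (fun y hy => hM y (by linarith [hy.1]) (by push_cast; linarith [hy.2]))
          ⟨le_rfl, by linarith⟩ ⟨by linarith, le_rfl⟩
        rwa [add_sub_cancel_left, Real.norm_eq_abs, abs_of_nonneg hv] at h1)
    have e : fwdDiff v (G (k + 1)) = fun x => G (k + 1) (x + v) - G (k + 1) x := rfl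
    rw [e]
    refine h.trans (le_of_eq ?_)
    ring

variable (K : Type*) [Field K] [NumberField K]

/-- Differentiating the power brings down s + k + 1, which cancels the last denominator. -/
lemma hasDerivAt_verticalKernel (k : ℕ) {x : ℝ} (hx : 0 < x) {s : ℂ} (hs : 0 < s.re) :
    HasDerivAt (fun x : ℝ => verticalKernel K (k + 1) x s) (verticalKernel K k x s) x := by
  have hne := add_natCast_ne_zero_of_re_pos hs (k + 1)
  have h1 : HasDerivAt (fun x : ℝ => (x : ℂ) ^ (s + (k + 1 : ℕ)))
      ((s + (k + 1 : ℕ)) * (x : ℂ) ^ (s + (k + 1 : ℕ) - 1)) x := by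
    have h := ((hasDerivAt_id (x : ℂ)).cpow_const (c := s + (k + 1 : ℕ))
      (Or.inl (by simpa using hx))).comp_ofReal
    simpa using h
  unfold verticalKernel
  refine ((h1.div_const _).mul_const _).congr_deriv ?_
  rw [Finset.prod_range_succ _ (k + 1)]
  have e : s + ((k + 1 : ℕ) : ℂ) - 1 = s + k := by push_cast; ring
  have hp : ∏ j ∈ Finset.range (k + 1), (s + (j : ℂ)) ≠ 0 :=
    Finset.prod_ne_zero_iff.2 fun j _ => add_natCast_ne_zero_of_re_pos hs j
  rw [e]
  field_simp

lemma continuous_verticalKernel_line (k : ℕ) {x : ℝ} (hx : 0 < x) {σ : ℝ} (h0 : 0 < σ)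
    (h1 : σ < 1) :
    Continuous fun t : ℝ => verticalKernel K k x ((σ : ℂ) + (t : ℂ) * Complex.I) := by
  refine (continuous_continuedKernel_line K k hx (by linarith) h1).congr fun t => ?_
  refine (verticalKernel_eq_continuedKernel K k hx fun h => h0.ne' ?_).symm
  simpa using congrArg Complex.re h

lemma hasDerivAt_integral_verticalKernel (k : ℕ) {x : ℝ} (hx : 0 < x) {σ : ℝ} (h0 : 0 < σ)
    (h1 : σ < 1) (T : ℝ) :
    HasDerivAt (fun x : ℝ =>
        ∫ t in (-T)..T, verticalKernel K (k + 1) x ((σ : ℂ) + (t : ℂ) * Complex.I))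
      (∫ t in (-T)..T, verticalKernel K k x ((σ : ℂ) + (t : ℂ) * Complex.I)) x := by
  have hball : ∀ y ∈ Metric.ball x (x / 2), 0 < y ∧ y ≤ 2 * x := by
    intro y hy
    rw [Metric.mem_ball, Real.dist_eq] at hy
    have := abs_lt.1 hy
    constructor <;> linarith [this.1, this.2]
  have hc := continuous_verticalKernel_line K k (x := 2 * x) (by linarith) h0 h1
  -- The norm of the kernel depends on y only through y^(σ+k), which increases in y, so its value at
  -- 2x dominates on the ball of radius x/2.
  refine (intervalIntegral.hasDerivAt_integral_of_dominated_loc_of_deriv_le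
    (F := fun x t => verticalKernel K (k + 1) x ((σ : ℂ) + (t : ℂ) * Complex.I))
    (F' := fun x t => verticalKernel K k x ((σ : ℂ) + (t : ℂ) * Complex.I))
    (bound := fun t => ‖verticalKernel K k (2 * x) ((σ : ℂ) + (t : ℂ) * Complex.I)‖)
    (Metric.ball_mem_nhds x (by linarith : 0 < x / 2)) ?_ ?_ ?_ ?_ ?_ ?_).2
  · filter_upwards [lt_mem_nhds hx] with y hy
    exact (continuous_verticalKernel_line K (k + 1) hy h0 h1).aestronglyMeasurable
  · exact (continuous_verticalKernel_line K (k + 1) hx h0 h1).intervalIntegrable _ _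
  · exact (continuous_verticalKernel_line K k hx h0 h1).aestronglyMeasurable
  · refine Eventually.of_forall fun t _ y hy => ?_
    have hy' := hball y hy
    simp only [verticalKernel, norm_mul, norm_div]
    rw [Complex.norm_cpow_eq_rpow_re_of_pos hy'.1,
      Complex.norm_cpow_eq_rpow_re_of_pos (by linarith : 0 < 2 * x)]
    have hre : ((σ : ℂ) + (t : ℂ) * Complex.I + (k : ℂ)).re = σ + k := by simp
    rw [hre]
    have := hy'.1
    gcongr
    exact hy'.2
  · exact hc.norm.intervalIntegrable _ _
  · refine Eventually.of_forall fun t _ y hy => ?_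
    exact hasDerivAt_verticalKernel K k (hball y hy).1 (by simpa using h0)

end Differences

/-! ### Comparison with Q₂ and Q₃ -/

section Constants

/-- The powers match because √2·π·e^4 > 240, and the remaining factor 8 e^(-1/2) √(3n) is at least
10 already for n = 2. -/
lemma ten_mul_pow_le {n : ℕ} (hn : 2 ≤ n) :
    10 * (240 : ℝ) ^ n ≤ 2 ^ ((n : ℝ) / 2 + 3) * Real.pi ^ (n : ℝ)
      * (Real.exp (4 * n - 1 / 2) * √(3 * n)) := by
  have hnR : (2 : ℝ) ≤ n := by exact_mod_cast hn
  have h2 : (2 : ℝ) ^ ((n : ℝ) / 2 + 3) = 8 * √2 ^ n := by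
    rw [Real.rpow_add (by norm_num), Real.sqrt_eq_rpow, ← Real.rpow_natCast (2 ^ (1 / 2 : ℝ)),
      ← Real.rpow_mul (by norm_num)]
    norm_num
    ring_nf
  have he : Real.exp (4 * n - 1 / 2) = Real.exp 4 ^ n * Real.exp (-(1 / 2)) := by
    rw [← Real.exp_nat_mul, ← Real.exp_add]; ring_nf
  have he4 : 54.59 ≤ Real.exp 4 := by
    have : Real.exp 4 = Real.exp 1 ^ 4 := by rw [← Real.exp_nat_mul]; norm_num
    rw [this]
    calc (54.59 : ℝ) ≤ 2.7182818283 ^ 4 := by norm_num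
      _ ≤ _ := by gcongr; exact Real.exp_one_gt_d9.le
  have hs2 : 1.414 ≤ √2 := Real.le_sqrt_of_sq_le (by norm_num)
  have hbase : 240 ≤ √2 * Real.pi * Real.exp 4 := by
    calc (240 : ℝ) ≤ 1.414 * 3.1415 * 54.59 := by norm_num
      _ ≤ _ := by gcongr; exact Real.pi_gt_d4.le
  have htail : 10 ≤ 8 * (Real.exp (-(1 / 2)) * √(3 * n)) := by
    have h1 : Real.exp (-(1 / 2)) = √(Real.exp (-1)) := by
      rw [← Real.exp_half]; ring_nf
    rw [h1, ← Real.sqrt_mul (Real.exp_pos _).le]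
    have h3 : 1.25 ≤ √(Real.exp (-1) * (3 * n)) := by
      apply Real.le_sqrt_of_sq_le
      have : 0.3 ≤ Real.exp (-1) := by linarith [Real.exp_neg_one_gt_d9]
      nlinarith
    linarith
  rw [h2, he, Real.rpow_natCast]
  calc 10 * (240 : ℝ) ^ n ≤ (8 * (Real.exp (-(1 / 2)) * √(3 * n)))
        * (√2 * Real.pi * Real.exp 4) ^ n := by gcongr
    _ = _ := by rw [mul_pow, mul_pow]; ring

variable (K : Type*) [Field K] [NumberField K]

lemma scaleConst_mul_scaledVar_rpow {n : ℕ} (hn : Module.finrank ℚ K = n) {x : ℝ} (hx : 0 < x)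
    (c : ℝ) : scaleConst K x * scaledVar K x ^ (-c)
      = x ^ (1 - c) * absDiscr K ^ (c - 1 / 2) * (2 ^ (n : ℝ) * (2 * Real.pi) ^ (-(n * c))) := by
  have hD := absDiscr_pos K
  have hp : 0 < 2 * Real.pi := by have := Real.pi_pos; positivity
  rw [scaleConst, scaledVar, hn, Real.div_rpow (by positivity) hD.le,
    Real.mul_rpow hx.le (by positivity), ← Real.rpow_natCast (2 * Real.pi), ← Real.rpow_mul hp.le,
    sub_eq_add_neg 1 c, Real.rpow_add hx, Real.rpow_one, sub_eq_add_neg c, Real.rpow_add hD,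
    Real.rpow_neg hD.le c, Real.rpow_natCast 2, mul_neg]
  have : absDiscr K ^ c ≠ 0 := (Real.rpow_pos_of_pos hD _).ne'
  field_simp

/-- Of the exponent in Q₃ only the lower bound 4n - 1/2 matters; the powers of 2 and π agree
exactly. -/
lemma two_pi_rpow_mul_le_constQ3 {n : ℕ} (hn : 2 ≤ n) {c : ℝ}
    (hc : c = 1 / 2 + 1 / (2 * (n : ℝ))) :
    1 / (2 * Real.pi) * (2 ^ (n : ℝ) * (2 * Real.pi) ^ (-(n * c))) * (2 * (5 * 240 ^ n))
      ≤ constQ3 n := by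
  have hnR : (2 : ℝ) ≤ n := by exact_mod_cast hn
  have hp := Real.pi_pos
  have hnc : n * c = n / 2 + 1 / 2 := by rw [hc]; field_simp
  have h := ten_mul_pow_le hn
  have hE : Real.exp (4 * n - 1 / 2)
      ≤ Real.exp ((n : ℝ) * (1 + 4 * n / ((n : ℝ) - 1)) - 1 / 2) := by
    apply Real.exp_le_exp.2
    have h1 : 4 ≤ 4 * (n : ℝ) / ((n : ℝ) - 1) := by
      rw [le_div_iff₀ (by linarith)]; linarith
    nlinarith
  have e1 : 1 / (2 * Real.pi) * (2 ^ (n : ℝ) * (2 * Real.pi) ^ (-(n * c)))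
      = 2 ^ ((n : ℝ) / 2 - 3 / 2) * Real.pi ^ (-(n : ℝ) / 2 - 3 / 2) := by
    rw [hnc, Real.mul_rpow (by norm_num) hp.le, one_div, mul_inv, ← Real.rpow_neg_one 2,
      ← Real.rpow_neg_one Real.pi]
    calc _ = ((2 : ℝ) ^ (-1 : ℝ) * 2 ^ (n : ℝ) * 2 ^ (-((n : ℝ) / 2 + 1 / 2)))
          * (Real.pi ^ (-1 : ℝ) * Real.pi ^ (-((n : ℝ) / 2 + 1 / 2))) := by ring
      _ = _ := by
          rw [← Real.rpow_add two_pos, ← Real.rpow_add two_pos, ← Real.rpow_add hp]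
          ring_nf
  have e2 : 2 ^ ((n : ℝ) / 2 - 3 / 2) * Real.pi ^ (-(n : ℝ) / 2 - 3 / 2)
      * (2 ^ ((n : ℝ) / 2 + 3) * Real.pi ^ (n : ℝ))
      = 2 ^ ((n : ℝ) + 3 / 2) * Real.pi ^ ((n : ℝ) / 2 - 3 / 2) := by
    calc _ = ((2 : ℝ) ^ ((n : ℝ) / 2 - 3 / 2) * 2 ^ ((n : ℝ) / 2 + 3))
          * (Real.pi ^ (-(n : ℝ) / 2 - 3 / 2) * Real.pi ^ (n : ℝ)) := by ring
      _ = _ := by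
          rw [← Real.rpow_add two_pos, ← Real.rpow_add hp]
          ring_nf
  rw [e1, constQ3, ← e2]
  calc _ = 2 ^ ((n : ℝ) / 2 - 3 / 2) * Real.pi ^ (-(n : ℝ) / 2 - 3 / 2) * (10 * 240 ^ n) := by ring
    _ ≤ 2 ^ ((n : ℝ) / 2 - 3 / 2) * Real.pi ^ (-(n : ℝ) / 2 - 3 / 2)
        * (2 ^ ((n : ℝ) / 2 + 3) * Real.pi ^ (n : ℝ)
          * (Real.exp ((n : ℝ) * (1 + 4 * n / ((n : ℝ) - 1)) - 1 / 2) * √(3 * n))) := by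
        refine mul_le_mul_of_nonneg_left (h.trans ?_) (by positivity)
        gcongr
    _ = _ := by ring

lemma two_pi_rpow_mul_le_constQ2 {n : ℕ} (hn : 2 ≤ n) {c : ℝ}
    (hc : c = 1 / 2 + 1 / (2 * (n : ℝ))) :
    1 / (2 * Real.pi) * (2 ^ (n : ℝ) * (2 * Real.pi) ^ (-(n * c))) / (2 * Real.pi) ^ n
      * (2 * (5 * 240 ^ n)) ≤ constQ2 n := by
  have hnR : (2 : ℝ) ≤ n := by exact_mod_cast hn
  have hp := Real.pi_pos
  have hnc : n * c = n / 2 + 1 / 2 := by rw [hc]; field_simp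
  have h := ten_mul_pow_le hn
  have e1 : 1 / (2 * Real.pi) * (2 ^ (n : ℝ) * (2 * Real.pi) ^ (-(n * c))) / (2 * Real.pi) ^ n
      = 2 ^ (-(n : ℝ) / 2 - 3 / 2) * Real.pi ^ (-(3 * n : ℝ) / 2 - 3 / 2) := by
    rw [hnc, div_eq_mul_inv _ ((2 * Real.pi) ^ n), ← Real.rpow_natCast, ← Real.rpow_neg
      (by positivity), Real.mul_rpow (by norm_num) hp.le, Real.mul_rpow (by norm_num) hp.le,
      one_div, mul_inv, ← Real.rpow_neg_one 2, ← Real.rpow_neg_one Real.pi]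
    calc _ = ((2 : ℝ) ^ (-1 : ℝ) * 2 ^ (n : ℝ) * 2 ^ (-((n : ℝ) / 2 + 1 / 2)) * 2 ^ (-(n : ℝ)))
          * (Real.pi ^ (-1 : ℝ) * Real.pi ^ (-((n : ℝ) / 2 + 1 / 2)) * Real.pi ^ (-(n : ℝ))) := by
            ring
      _ = _ := by
          rw [← Real.rpow_add two_pos, ← Real.rpow_add two_pos, ← Real.rpow_add two_pos,
            ← Real.rpow_add hp, ← Real.rpow_add hp]
          ring_nf
  have e2 : 2 ^ (-(n : ℝ) / 2 - 3 / 2) * Real.pi ^ (-(3 * n : ℝ) / 2 - 3 / 2)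
      * (2 ^ ((n : ℝ) / 2 + 3) * Real.pi ^ (n : ℝ))
      = 2 ^ (3 / 2 : ℝ) * Real.pi ^ (-(n : ℝ) / 2 - 3 / 2) := by
    calc _ = ((2 : ℝ) ^ (-(n : ℝ) / 2 - 3 / 2) * 2 ^ ((n : ℝ) / 2 + 3))
          * (Real.pi ^ (-(3 * n : ℝ) / 2 - 3 / 2) * Real.pi ^ (n : ℝ)) := by ring
      _ = _ := by
          rw [← Real.rpow_add two_pos, ← Real.rpow_add hp]
          ring_nf
  rw [e1, constQ2, ← e2]
  calc _ = 2 ^ (-(n : ℝ) / 2 - 3 / 2) * Real.pi ^ (-(3 * n : ℝ) / 2 - 3 / 2)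
        * (10 * 240 ^ n) := by ring
    _ ≤ 2 ^ (-(n : ℝ) / 2 - 3 / 2) * Real.pi ^ (-(3 * n : ℝ) / 2 - 3 / 2)
        * (2 ^ ((n : ℝ) / 2 + 3) * Real.pi ^ (n : ℝ)
          * (Real.exp (4 * n - 1 / 2) * √(3 * n))) :=
        mul_le_mul_of_nonneg_left h (by positivity)
    _ = _ := by ring

end Constants

/-! ### Bounds for K and its differences -/

section Main

variable (K : Type*) [Field K] [NumberField K]

/-- The truncated integral on the line `re s = 1/2 - 1/(2n)` with the kernel differentiated `n`
times. -/
lemma norm_integral_verticalKernel_zero_le_constQ3 {n : ℕ} (hn : Module.finrank ℚ K = n)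
    (hn2 : 2 ≤ n) {c : ℝ} (hc : c = 1 / 2 + 1 / (2 * (n : ℝ))) {x : ℝ} (hx : 0 < x) {T : ℝ}
    (hT : 0 ≤ T) :
    1 / (2 * Real.pi)
      * ‖∫ t in (-T)..T, verticalKernel K 0 x (((1 - c : ℝ) : ℂ) + (t : ℂ) * Complex.I)‖
      ≤ constQ3 n * absDiscr K ^ (c - 1 / 2) * x ^ (1 - c) := by
  have hp := Real.pi_pos
  have hD := Real.rpow_pos_of_pos (absDiscr_pos K) (c - 1 / 2)
  have hxc := Real.rpow_pos_of_pos hx (1 - c)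
  calc _ ≤ 1 / (2 * Real.pi) * (scaleConst K x * (2 * (scaledVar K x ^ (-c) * (5 * 240 ^ n)))) := by
        gcongr
        exact norm_integral_verticalKernel_zero_le K hn hn2 hc hx hT
    _ = 1 / (2 * Real.pi) * (scaleConst K x * scaledVar K x ^ (-c)) * (2 * (5 * 240 ^ n)) := by
        ring
    _ = (1 / (2 * Real.pi) * (2 ^ (n : ℝ) * (2 * Real.pi) ^ (-(n * c))) * (2 * (5 * 240 ^ n)))
        * absDiscr K ^ (c - 1 / 2) * x ^ (1 - c) := by
        rw [scaleConst_mul_scaledVar_rpow K hn hx]; ring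
    _ ≤ _ := by
        gcongr
        exact two_pi_rpow_mul_le_constQ3 hn2 hc

lemma norm_integral_verticalKernel_finrank_le_constQ2 {n : ℕ} (hn : Module.finrank ℚ K = n)
    (hn2 : 2 ≤ n) {c : ℝ} (hc : c = 1 / 2 + 1 / (2 * (n : ℝ))) {x : ℝ} (hx : 0 < x) {T : ℝ}
    (hT : 0 ≤ T) :
    1 / (2 * Real.pi)
      * ‖∫ t in (-T)..T, verticalKernel K n x (((-c : ℝ) : ℂ) + (t : ℂ) * Complex.I)‖
      ≤ constQ2 n * absDiscr K ^ (c + 1 / 2) * x ^ (n - c) := by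
  have hp := Real.pi_pos
  have hD := absDiscr_pos K
  have hDc := Real.rpow_pos_of_pos hD (c + 1 / 2)
  have hxc := Real.rpow_pos_of_pos hx (n - c)
  have ex : x ^ ((n : ℝ) - c) = x ^ (1 - c) * x ^ n / x := by
    rw [← Real.rpow_natCast x n, ← Real.rpow_add hx, ← Real.rpow_sub_one hx.ne']
    ring_nf
  have eD : absDiscr K ^ (c + 1 / 2) = absDiscr K ^ (c - 1 / 2) * absDiscr K := by
    rw [← Real.rpow_add_one hD.ne']; ring_nf
  calc _ ≤ 1 / (2 * Real.pi) * (scaleConst K x * x ^ n * (scaledVar K x)⁻¹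
        * (2 * (scaledVar K x ^ (-c) * (5 * 240 ^ n)))) := by
        gcongr
        exact norm_integral_verticalKernel_finrank_le K hn hn2 hc hx hT
    _ = 1 / (2 * Real.pi) * (scaleConst K x * scaledVar K x ^ (-c)) * (x ^ n * (scaledVar K x)⁻¹)
        * (2 * (5 * 240 ^ n)) := by
        ring
    _ = (1 / (2 * Real.pi) * (2 ^ (n : ℝ) * (2 * Real.pi) ^ (-(n * c))) / (2 * Real.pi) ^ n
        * (2 * (5 * 240 ^ n))) * absDiscr K ^ (c + 1 / 2) * x ^ ((n : ℝ) - c) := by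
        rw [scaleConst_mul_scaledVar_rpow K hn hx, ex, eD, scaledVar, hn]
        field_simp
    _ ≤ _ := by
        gcongr
        exact two_pi_rpow_mul_le_constQ2 hn2 hc

lemma landauTruncated_eq {η x T : ℝ} (h1 : -1 < η) (h2 : η < 1) :
    landauTruncated K η x T = (1 / (2 * Real.pi) : ℝ) * ∫ t in (-T)..T,
      verticalKernel K (Module.finrank ℚ K) x (((-η : ℝ) : ℂ) + (t : ℂ) * Complex.I) := by
  have hp : (Real.pi : ℂ) ≠ 0 := by exact_mod_cast Real.pi_ne_zero
  rw [landauTruncated, intervalIntegral.integral_mul_const]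
  have e : ∀ t : ℝ, landauIntegrand K x (-(η : ℂ) + (t : ℂ) * Complex.I)
      = verticalKernel K (Module.finrank ℚ K) x (((-η : ℝ) : ℂ) + (t : ℂ) * Complex.I) := by
    intro t
    rw [landauIntegrand_eq K x (by simpa using h2) (by simp; linarith)]
    push_cast
    rfl
  rw [intervalIntegral.integral_congr fun t _ => e t]
  push_cast
  field_simp [Complex.I_ne_zero]

/-- The limits of the truncated integrals on the various lines. -/
lemma exists_landauK_limit {n : ℕ} (hn : Module.finrank ℚ K = n) (hn2 : 2 ≤ n) {c : ℝ}
    (hc : c = 1 / 2 + 1 / (2 * (n : ℝ))) {η : ℝ} (hη : (0 < η ∧ η < 1 / 2) ∨ η = c) {x : ℝ}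
    (hx : 0 < x) :
    Tendsto (fun T : ℝ => landauTruncated K η x T) atTop (𝓝 (landauK K η x)) ∧
    ∀ σ : ℝ, -c ≤ σ → σ ≤ 1 - c → σ ≠ 0 →
      Tendsto (fun T : ℝ => (1 / (2 * Real.pi) : ℝ) * ∫ t in (-T)..T,
        verticalKernel K n x ((σ : ℂ) + (t : ℂ) * Complex.I)) atTop (𝓝 (landauK K η x)) := by
  have hnR : (2 : ℝ) ≤ n := by exact_mod_cast hn2
  have hc1 : 1 / 2 < c := by rw [hc]; have : 0 < 1 / (2 * (n : ℝ)) := by positivity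
                             linarith
  have hc2 : c ≤ 3 / 4 := by
    have : 1 / (2 * (n : ℝ)) ≤ 1 / 4 := one_div_le_one_div_of_le (by norm_num) (by linarith)
    rw [hc]; linarith
  -- Only 0 < η ≤ c matters: all these abscissae lead to the same limit.
  have hη' : 0 < η ∧ η ≤ c := by
    rcases hη with h | h
    · exact ⟨h.1, by linarith [h.2]⟩
    · constructor <;> linarith
  obtain ⟨L, hL⟩ := exists_tendsto_integral_verticalKernel K hn hn2 hc hx
  have hL' : ∀ σ : ℝ, -c ≤ σ → σ ≤ 1 - c → σ ≠ 0 →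
      Tendsto (fun T : ℝ => (((1 / (2 * Real.pi) : ℝ) : ℂ) * ∫ t in (-T)..T,
        verticalKernel K n x ((σ : ℂ) + (t : ℂ) * Complex.I))) atTop
        (𝓝 (((1 / (2 * Real.pi) : ℝ) : ℂ) * L)) :=
    fun σ h1 h2 h0 => (hL σ h1 h2 h0).const_mul _
  have hT : Tendsto (fun T : ℝ => landauTruncated K η x T) atTop
      (𝓝 (((1 / (2 * Real.pi) : ℝ) : ℂ) * L)) := by
    refine (hL' (-η) (by linarith [hη'.2]) (by linarith [hη'.1])
      (neg_ne_zero.2 hη'.1.ne')).congr fun T => ?_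
    rw [landauTruncated_eq K (by linarith [hη'.1]) (by linarith [hη'.2]), hn]
  have hK : landauK K η x = ((1 / (2 * Real.pi) : ℝ) : ℂ) * L := hT.limUnder_eq
  rw [hK]
  exact ⟨hT, hL'⟩

/-- Whatever η is, K is evaluated on Re s = -c, where the truncated integrals are bounded uniformly
in T. -/
lemma norm_landauK_le {n : ℕ} (hn : Module.finrank ℚ K = n) (hn2 : 2 ≤ n) {c : ℝ}
    (hc : c = 1 / 2 + 1 / (2 * (n : ℝ))) {η : ℝ} (hη : (0 < η ∧ η < 1 / 2) ∨ η = c) {x : ℝ}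
    (hx : 0 < x) :
    ‖landauK K η x‖ ≤ constQ2 n * absDiscr K ^ (c + 1 / 2) * x ^ ((n : ℝ) - c) := by
  have hn0 : (0 : ℝ) < n := by exact_mod_cast (by omega : 0 < n)
  have hc0 : 0 < c := by rw [hc]; positivity
  have hp := Real.pi_pos
  have hc1 : c ≤ 1 := by
    have hnR : (2 : ℝ) ≤ n := by exact_mod_cast hn2
    have : 1 / (2 * (n : ℝ)) ≤ 1 / 4 := one_div_le_one_div_of_le (by norm_num) (by linarith)
    rw [hc]; linarith
  have hlim := ((exists_landauK_limit K hn hn2 hc hη hx).2 (-c) le_rfl (by linarith)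
    (neg_ne_zero.2 hc0.ne')).norm
  refine le_of_tendsto hlim ?_
  filter_upwards [eventually_ge_atTop 0] with T hT
  rw [norm_mul, Complex.norm_real, Real.norm_eq_abs, abs_of_pos (by positivity)]
  exact norm_integral_verticalKernel_finrank_le_constQ2 K hn hn2 hc hx hT

lemma constQ2_pos {n : ℕ} (hn : 0 < n) : 0 < constQ2 n := by
  have : (0 : ℝ) < n := by exact_mod_cast hn
  have := Real.pi_pos
  unfold constQ2; positivity

lemma constQ3_pos {n : ℕ} (hn : 0 < n) : 0 < constQ3 n := by
  have : (0 : ℝ) < n := by exact_mod_cast hn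
  have := Real.pi_pos
  unfold constQ3; positivity

lemma norm_nthDifference_le_of_norm_le {n : ℕ} {v w : ℝ} {g : ℝ → ℂ} {M : ℝ}
    (hg : ∀ l ≤ n, ‖g (w + (l : ℝ) * v)‖ ≤ M) : ‖nthDifference n v g w‖ ≤ 2 ^ n * M := by
  rw [nthDifference]
  refine (norm_sum_le_of_le _ (fun l hl => ?_)).trans
    (le_of_eq (a := ∑ l ∈ Finset.range (n + 1), (n.choose l : ℝ) * M) ?_)
  · rw [norm_mul, norm_mul, norm_pow, norm_neg, norm_one, one_pow, one_mul, Complex.norm_natCast]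
    gcongr
    exact hg l (by simpa [Nat.lt_succ_iff] using hl)
  · rw [← Finset.sum_mul]
    congr 1
    exact_mod_cast Nat.sum_range_choose n

end Main

theorem proposition4p3 (K : Type*) [Field K] [NumberField K] (n : ℕ)
    (hn : Module.finrank ℚ K = n) (hn2 : 2 ≤ n) (η : ℝ)
    (hη : (0 < η ∧ η < 1 / 2) ∨ η = 1 / 2 + 1 / (2 * (n : ℝ))) :
    (∀ x : ℝ, 0 < x →
      Tendsto (fun T : ℝ => landauTruncated K η x T) atTop (𝓝 (landauK K η x))) ∧
    ∀ w v : ℝ, 1 < w → 0 < v → v < w →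
      ‖nthDifference n v (landauK K η) w‖ ≤
          constQ4 n * (|NumberField.discr K| : ℝ) ^ (1 + 1 / (2 * (n : ℝ)))
            * w ^ ((n : ℝ) - 1 / 2 - 1 / (2 * (n : ℝ))) ∧
      ‖nthDifference n v (landauK K η) w‖ ≤
          constQ5 n * v ^ n * (|NumberField.discr K| : ℝ) ^ (1 / (2 * (n : ℝ)))
            * w ^ (1 / 2 - 1 / (2 * (n : ℝ))) := by
  obtain ⟨c, hc⟩ : ∃ c : ℝ, c = 1 / 2 + 1 / (2 * (n : ℝ)) := ⟨_, rfl⟩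
  have hnR : (2 : ℝ) ≤ n := by exact_mod_cast hn2
  have hn0 : 0 < n := by omega
  have hp := Real.pi_pos
  have hc1 : 1 / 2 < c := by rw [hc]; have : 0 < 1 / (2 * (n : ℝ)) := by positivity
                             linarith
  have hc2 : c ≤ 3 / 4 := by
    have : 1 / (2 * (n : ℝ)) ≤ 1 / 4 := one_div_le_one_div_of_le (by norm_num) (by linarith)
    rw [hc]; linarith
  rw [← hc] at hη
  have hQ2 := constQ2_pos hn0
  have hQ3 := constQ3_pos hn0
  refine ⟨fun x hx => (exists_landauK_limit K hn hn2 hc hη hx).1, fun w v hw hv hvw => ⟨?_, ?_⟩⟩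
  · have hDc := Real.rpow_pos_of_pos (absDiscr_pos K) (c + 1 / 2)
    have hwc := Real.rpow_pos_of_pos (by linarith : 0 < w) (n - c)
    have hb := norm_nthDifference_le_of_norm_le (n := n) (v := v) (w := w) (g := landauK K η)
      (M := constQ2 n * absDiscr K ^ (c + 1 / 2) * (2 * n * w) ^ ((n : ℝ) - c)) (by
        intro l hl
        have hlR : (l : ℝ) ≤ n := by exact_mod_cast hl
        have hl0 : (0 : ℝ) ≤ l := Nat.cast_nonneg l
        have hpos : 0 < w + l * v := by positivity
        refine (norm_landauK_le K hn hn2 hc hη hpos).trans ?_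
        -- From l ≤ n and v < w the argument is at most (n + 1)w, hence at most 2nw.
        have hle : w + l * v ≤ 2 * n * w := by
          have : (l : ℝ) * v ≤ n * w := by gcongr
          nlinarith
        gcongr
        linarith)
    refine hb.trans ?_
    -- Dropping c from the exponent leaves 2^n (2n)^n = (4n)^n.
    have h2n : (2 * (n : ℝ)) ^ ((n : ℝ) - c) ≤ (2 * n) ^ n := by
      rw [← Real.rpow_natCast]
      exact Real.rpow_le_rpow_of_exponent_le (by linarith) (by linarith)
    have e1 : (n : ℝ) - 1 / 2 - 1 / (2 * (n : ℝ)) = n - c := by rw [hc]; ring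
    have e2 : 1 + 1 / (2 * (n : ℝ)) = c + 1 / 2 := by rw [hc]; ring
    have e3 : |(NumberField.discr K : ℝ)| = absDiscr K := rfl
    rw [e1, e2, e3, constQ4, Real.mul_rpow (by positivity) (by linarith)]
    calc _ ≤ 2 ^ n * (constQ2 n * absDiscr K ^ (c + 1 / 2) * ((2 * n) ^ n * w ^ ((n : ℝ) - c))) := by
          gcongr
      _ = constQ2 n * (2 * (2 * n)) ^ n * absDiscr K ^ (c + 1 / 2) * w ^ ((n : ℝ) - c) := by
          rw [mul_pow 2 (2 * (n : ℝ))]; ring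
      _ = _ := by ring_nf
  · have hw0 : 0 < w := by linarith
    have hDc := Real.rpow_pos_of_pos (absDiscr_pos K) (c - 1 / 2)
    set M : ℝ := constQ3 n * absDiscr K ^ (c - 1 / 2) * ((n + 1) * w) ^ (1 - c) with hM
    -- The differences are estimated at finite height, where differentiation under the integral is
    -- legitimate, and T → ∞ comes afterwards; convergence of the differentiated integrals is never
    -- needed.
    set G : ℝ → ℕ → ℝ → ℂ := fun T k x => ((1 / (2 * Real.pi) : ℝ) : ℂ) * ∫ t in (-T)..T,
      verticalKernel K k x (((1 - c : ℝ) : ℂ) + (t : ℂ) * Complex.I) with hG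
    have hdiff : ∀ T, 0 ≤ T → ‖nthDifference n v (G T n) w‖ ≤ v ^ n * M := by
      intro T hT
      rw [nthDifference_eq_fwdDiff_iter]
      refine norm_fwdDiff_iter_le hv.le n (G T) M ?_ ?_
      · intro j x hx
        exact (hasDerivAt_integral_verticalKernel K j (by linarith) (by linarith) (by linarith)
          T).const_mul _
      · intro x hx hx'
        have hx0 : 0 < x := by linarith
        simp only [hG]
        rw [norm_mul, Complex.norm_real, Real.norm_eq_abs, abs_of_pos (by positivity)]
        refine (norm_integral_verticalKernel_zero_le_constQ3 K hn hn2 hc hx0 hT).trans ?_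
        rw [hM]
        have hle : x ≤ (n + 1) * w := by
          have : (n : ℝ) * v ≤ n * w := by gcongr
          linarith
        gcongr
        linarith
    have hlim : Tendsto (fun T => nthDifference n v (G T n) w) atTop
        (𝓝 (nthDifference n v (landauK K η) w)) := by
      simp only [nthDifference]
      refine tendsto_finsetSum _ fun l _ => Tendsto.const_mul _ ?_
      exact (exists_landauK_limit K hn hn2 hc hη (by positivity : 0 < w + l * v)).2 (1 - c)
        (by linarith) le_rfl (by linarith)
    have hfin : ‖nthDifference n v (landauK K η) w‖ ≤ v ^ n * M := by
      refine le_of_tendsto hlim.norm ?_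
      filter_upwards [eventually_ge_atTop 0] with T hT using hdiff T hT
    refine hfin.trans (le_of_eq ?_)
    have e1 : 1 / 2 - 1 / (2 * (n : ℝ)) = 1 - c := by rw [hc]; ring
    have e2 : 1 / (2 * (n : ℝ)) = c - 1 / 2 := by rw [hc]; ring
    have e3 : |(NumberField.discr K : ℝ)| = absDiscr K := rfl
    rw [constQ5, e1, e2, e3, hM, Real.mul_rpow (by positivity) hw0.le]
    ring
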